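/- **Setting.** Let $d\ge1$, $\Omega=\prod_{i=1}^d(a_i,b_i)\subset\mathbb R^d$ a box, $V=H^1_0(\Omega)$ or $V=H^1_p(\Omega)$ (periodic functions), with real or complex scalars, $\|v\|_V^2=\int_\Omega|v|^2+|\nabla v|^2$, and let $Lu=-\nabla\cdot(\nu\nabla u)+\sigma u$ with real coefficients $0<\nu_*\le\nu\le\nu^*$, $0<\sigma_*\le\sigma\le\sigma^*$ in $\Omega$, $\alpha_*=\min(\nu_*,\sigma_*)$, $\alpha^*=\max(\nu^*,\sigma^*)$, $a(u,v)=\int_\Omega\nu\nabla u\cdot\nabla\bar v+\sigma u\bar v$, $|||v|||=\sqrt{a(v,v)}$. Let $(\phi_k)_{k\in\mathcal K}$, $\mathcal K\subseteq\mathbb Z^d$, be a Riesz basis of $V$ with weights $d_k>0$: $v=\sum_k\hat v_k\phi_k\mapsto(\hat v_k\sqrt{d_k})_k$ is an isomorphism of $V$ onto $\ell^2(\mathcal K)$ and $\beta_*\|v\|_V\le\|v\|_\phi:=(\sum_k|\hat v_k|^2d_k)^{1/2}\le\beta^*\|v\|_V$, $\beta_*>0$. For a functional $g$ on $V$ put $\hat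 g_k=\langle g,\phi_k\rangle$ and $\|g\|_{\phi^*}=(\sum_k|\hat g_k|^2d_k^{-1})^{1/2}$. Assume that the (normalized) stiffness matrix $\mathbf A=(a(\phi_k,\phi_\ell)/\sqrt{d_\ell d_k})_{\ell,k}$ satisfies $|\mathbf A_{\ell,k}|\le c_Le^{-\eta_L|\ell-k|}$ with some $\eta_L>0$, where $|\cdot|$ is the Euclidean norm. Let $C_{\mathbf A^{-1}},\tilde\eta_L>0$ be such that $\|\mathbf A^{-1}-(\mathbf A^{-1})_J\|\le C_{\mathbf A^{-1}}e^{-\tilde\eta_LJ}$ for all $J\ge0$, where $(\mathbf A^{-1})_J$ keeps the entries with $|\ell-k|\le J$ and the norm is that of operators on $\ell^2(\mathcal K)$, and let $0<C_0\le\frac14\sqrt{\alpha_*/\alpha^*}\,\beta_*/\beta^*$. **Algorithm DYN-GAL($\varepsilon$)** for $f\in V^*$, $f\ne0$: start with $\Lambda_0=\emptyset$, $u_0=0$. For $n=0,1,2,\dots$ let $r_n=f-Lu_n$ and $\theta_n=(1-C_0^2\|r_n\|_{\phi^*}^2/\|f\|_{\phi^*}^2)^{1/2}$; let $\widetilde{\partial\Lambda}_n\subset\mathcal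 K$ be a set of minimal cardinality with $\sum_{k\in\widetilde{\partial\Lambda}_n}|\hat r_{n,k}|^2d_k^{-1}\ge\theta_n^2\|r_n\|_{\phi^*}^2$; let $J_n=J_n^0+\delta_n$, where $\delta_n\in[0,1)$ is a rounding and $J_n^0$ is the smallest $J\ge0$ with $C_{\mathbf A^{-1}}e^{-\tilde\eta_LJ}\le\sqrt{(1-\theta_n^2)/(\alpha_*\alpha^*)}$; let $\Lambda_{n+1}=\Lambda_n\cup\{k\in\mathcal K:|k-\ell|\le J_n\text{ for some }\ell\in\widetilde{\partial\Lambda}_n\}$ and let $u_{n+1}$ be the Galerkin solution in $V_{\Lambda_{n+1}}=\mathrm{span}\{\phi_k:k\in\Lambda_{n+1}\}$. Stop at the first $n$ with $\|r_{n+1}\|_{\phi^*}\le\varepsilon\|f\|_{\phi^*}$. **Gevrey class.** Let $\omega_d$ be the volume of the unit ball of $\mathbb R^d$ and $E_N(v)=\inf_{|\Lambda|=N}\|v-\sum_{k\in\Lambda}\hat v_k\phi_k\|_\phi$. For $\eta>0$, $0<t\le d$, $\mathcal A_G^{\eta,t}$ is the set of $v\in V$ with $\|v\|_{\mathcal A_G^{\eta,t}}=\sup_{N\ge0}E_N(v)\exp(\eta\,\omega_d^{-t/d}N^{t/d})<\infty$.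 **Theorem 5.1 (exponential convergence rate).** For all $\eta>0$, $0<t\le d$ there are $C_*>0$, $\eta_*\in(0,\eta)$ and $t_*\in(0,t)$, independent of $f$, $u$, $\varepsilon$ and the number of iterations, such that, whenever $f\ne0$, the solution $u\in V$ of $Lu=f$ lies in $\mathcal A_G^{\eta,t}$ and $0<\varepsilon<1$, upon termination of DYN-GAL($\varepsilon$) $$|||u-u_{n+1}|||\le\frac{\beta^*}{\sqrt{\alpha_*}}\|f\|_{\phi^*}\,\varepsilon,\qquad |\Lambda_{n+1}|\le\omega_d\Big(\frac1{\eta_*}\log\frac{C_*\|u\|_{\mathcal A_G^{\eta,t}}/\|f\|_{\phi^*}}{\varepsilon}\Big)^{d/t_*}.$$ Moreover, suppose that a linear solver solves every Galerkin system $\mathbf A_\Lambda x=g$ with at most $C_\#|\Lambda|$ arithmetic operations, and let the workload $\mathcal W_\varepsilon$ be the total number of operations to find, plus one unit per coefficient to store, the iterates $u_1,\dots,u_{n+1}$. Then there is $\eta^*\in(0,\eta_*)$ (depending also on $C_\#$) and, for each $\delta>0$, a constant $C^*>C_*$ such that, for all $f,u$ as above and all $\varepsilon\in(0,1)$ with $|\log|\log\varepsilon||\ge\delta$,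 upon termination $$\mathcal W_\varepsilon\le\omega_d\Big(\frac1{\eta^*}\log\frac{C^*\|u\|_{\mathcal A_G^{\eta,t}}/\|f\|_{\phi^*}}{\varepsilon^4|\log|\log\varepsilon||^{-1}}\Big)^{d/t_*}.$$ -/

import Mathlib

open MeasureTheory
open scoped ContDiff ENNReal ComplexConjugate

noncomputable section

namespace DynGal

/-! ### The elliptic boundary value problem on a box -/

/-- Periodic or homogeneous Dirichlet boundary conditions. -/
inductive BoundaryCondition where
  | periodic
  | dirichlet

/-- The data of `-∇·(ν ∇u) + σ u = f` in the box `Ω = ∏ (a i, b i)`: boundary condition and real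
coefficients, bounded above and below by positive constants. -/
structure EllipticProblem (d : ℕ) where
  a : Fin d → ℝ
  b : Fin d → ℝ
  a_lt_b : ∀ i, a i < b i
  bc : BoundaryCondition
  ν : EuclideanSpace ℝ (Fin d) → ℝ
  σ : EuclideanSpace ℝ (Fin d) → ℝ
  νLo : ℝ
  νHi : ℝ
  σLo : ℝ
  σHi : ℝ
  νLo_pos : 0 < νLo
  σLo_pos : 0 < σLo
  ν_meas : AEMeasurable ν (volume.restrict {x | ∀ i, x i ∈ Set.Ioo (a i) (b i)})
  σ_meas : AEMeasurable σ (volume.restrict {x | ∀ i, x i ∈ Set.Ioo (a i) (b i)})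
  ν_bounds : ∀ x : EuclideanSpace ℝ (Fin d), (∀ i, x i ∈ Set.Ioo (a i) (b i)) →
    νLo ≤ ν x ∧ ν x ≤ νHi
  σ_bounds : ∀ x : EuclideanSpace ℝ (Fin d), (∀ i, x i ∈ Set.Ioo (a i) (b i)) →
    σLo ≤ σ x ∧ σ x ≤ σHi

namespace EllipticProblem

variable {d : ℕ} (P : EllipticProblem d)

/-- The open box `Ω`. -/
def Ω : Set (EuclideanSpace ℝ (Fin d)) := {x | ∀ i, x i ∈ Set.Ioo (P.a i) (P.b i)}

/-- Lebesgue measure on `Ω`. -/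
def μ : Measure (EuclideanSpace ℝ (Fin d)) := volume.restrict P.Ω

/-- `α_* = min (ν_*, σ_*)`. -/
def αLo : ℝ := min P.νLo P.σLo

/-- `α^* = max (ν^*, σ^*)`. -/
def αHi : ℝ := max P.νHi P.σHi

end EllipticProblem

/-- Values of a function and of its gradient at a point, with the Euclidean norm. -/
abbrev Jet (𝕜 : Type) [RCLike 𝕜] (d : ℕ) : Type := WithLp 2 (𝕜 × EuclideanSpace 𝕜 (Fin d))

/-- The pair `(ψ x, ∇ψ x)`. -/
def jet {𝕜 : Type} [RCLike 𝕜] {d : ℕ} (ψ : EuclideanSpace ℝ (Fin d) → 𝕜)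
    (x : EuclideanSpace ℝ (Fin d)) : Jet 𝕜 d :=
  WithLp.toLp 2 (ψ x, WithLp.toLp 2 fun i => fderiv ℝ ψ x (EuclideanSpace.single i 1))

namespace EllipticProblem

variable {d : ℕ} (P : EllipticProblem d)

/-- Smooth functions compatible with the boundary condition: `C_c^∞(Ω)` in the Dirichlet case, the
smooth functions on `ℝ^d` with periods `b i - a i` in the periodic case. -/
def IsTestFunction {𝕜 : Type} [RCLike 𝕜] (ψ : EuclideanSpace ℝ (Fin d) → 𝕜) : Prop :=
  ContDiff ℝ ∞ ψ ∧
    match P.bc with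
    | .dirichlet => HasCompactSupport ψ ∧ tsupport ψ ⊆ P.Ω
    | .periodic => ∀ i x, ψ (x + EuclideanSpace.single i (P.b i - P.a i)) = ψ x

/-- The Sobolev space `V = H^1_0(Ω)` or `V = H^1_p(Ω)`: the closure in `H^1(Ω)` of the smooth
functions compatible with the boundary condition. An element `v` is represented by the class in
`L²(Ω)` of `(v, ∇v)`, so that the norm of `V` is `(∫ |v|² + |∇v|²)^{1/2}`. -/
def V (𝕜 : Type) [RCLike 𝕜] : Submodule 𝕜 (Lp (Jet 𝕜 d) 2 P.μ) :=
  (Submodule.span 𝕜 {U : Lp (Jet 𝕜 d) 2 P.μ |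
    ∃ ψ : EuclideanSpace ℝ (Fin d) → 𝕜, P.IsTestFunction ψ ∧ U =ᵐ[P.μ] jet ψ}).topologicalClosure

variable {𝕜 : Type} [RCLike 𝕜]

/-- The sesquilinear form `a(u,v) = ∫ ν ∇u · conj ∇v + ∫ σ u conj v`
(Mathlib's inner product is conjugate linear in its first argument). -/
def form (u v : P.V 𝕜) : 𝕜 :=
  (∫ x, (P.ν x : 𝕜) * inner 𝕜 ((v : Lp (Jet 𝕜 d) 2 P.μ) x).snd ((u : Lp (Jet 𝕜 d) 2 P.μ) x).snd ∂P.μ)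
  + ∫ x, (P.σ x : 𝕜) * inner 𝕜 ((v : Lp (Jet 𝕜 d) 2 P.μ) x).fst ((u : Lp (Jet 𝕜 d) 2 P.μ) x).fst ∂P.μ

/-- The energy norm `√a(v,v)`. -/
def energyNorm (v : P.V 𝕜) : ℝ := √(RCLike.re (P.form v v))

/-- `u ∈ V` solves `a(u,v) = ⟨f,v⟩` for all `v ∈ V`. As `a` is conjugate linear in `v`, the dual
space `V^*` consists of the continuous conjugate linear functionals. -/
def IsWeakSolution (f : P.V 𝕜 →L⋆[𝕜] 𝕜) (u : P.V 𝕜) : Prop :=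
  ∀ v, P.form u v = f v

/-- The residual `r(w) = f - L w`, as a functional on `V`. -/
def residual (f : P.V 𝕜 →L⋆[𝕜] 𝕜) (w : P.V 𝕜) : P.V 𝕜 → 𝕜 :=
  fun v => f v - P.form w v

end EllipticProblem

/-! ### Riesz bases, projections, stiffness matrix -/

/-- The Euclidean distance `|k - ℓ|` of two points of `ℤ^d`. -/
def latticeDist {d : ℕ} (k l : Fin d → ℤ) : ℝ :=
  ‖(WithLp.toLp 2 fun i => ((k i - l i : ℤ) : ℝ) : EuclideanSpace ℝ (Fin d))‖

/-- A Riesz basis `(φ k)` of `V`, indexed by `𝒦 ⊆ ℤ^d`, with weights `d_k > 0`: the map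
`v = ∑ v̂_k φ_k ↦ (v̂_k √d_k)` is an isomorphism of `V` onto `ℓ²(𝒦)`, and
`β_* ‖v‖_V ≤ (∑ |v̂_k|² d_k)^{1/2} ≤ β^* ‖v‖_V`. -/
structure RieszBasis {d : ℕ} (𝕜 : Type) [RCLike 𝕜] (K : Set (Fin d → ℤ)) (V : Type)
    [NormedAddCommGroup V] [NormedSpace 𝕜 V] where
  φ : K → V
  weight : K → ℝ
  weight_pos : ∀ k, 0 < weight k
  repr : V ≃L[𝕜] lp (fun _ : K => 𝕜) 2
  repr_φ : ∀ k, repr (φ k) = lp.single 2 k ((√(weight k) : ℝ) : 𝕜)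
  βLo : ℝ
  βHi : ℝ
  βLo_pos : 0 < βLo
  le_repr : ∀ v, βLo * ‖v‖ ≤ ‖repr v‖
  repr_le : ∀ v, ‖repr v‖ ≤ βHi * ‖v‖

namespace RieszBasis

variable {d : ℕ} {𝕜 : Type} [RCLike 𝕜] {K : Set (Fin d → ℤ)} {V : Type}
  [NormedAddCommGroup V] [NormedSpace 𝕜 V] (B : RieszBasis 𝕜 K V)

/-- The coefficient `v̂_k` of `v = ∑ v̂_k φ_k`. -/
def coeff (v : V) (k : K) : 𝕜 := B.repr v k / ((√(B.weight k) : ℝ) : 𝕜)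

/-- `‖v‖_φ = (∑ |v̂_k|² d_k)^{1/2}`. -/
def phiNorm (v : V) : ℝ := ‖B.repr v‖

/-- The subspace `V_Λ` spanned by the `φ_k`, `k ∈ Λ`. -/
def subspace (Λ : Finset K) : Submodule 𝕜 V := Submodule.span 𝕜 (B.φ '' (Λ : Set K))

/-- The projection `P_Λ v = ∑_{k ∈ Λ} v̂_k φ_k`. -/
def proj (Λ : Finset K) (v : V) : V := ∑ k ∈ Λ, B.coeff v k • B.φ k

/-- The normalized dual coefficients `ĝ_k d_k^{-1/2}`, `ĝ_k = ⟨g, φ_k⟩`, of a functional `g`. -/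
def dualCoeff (g : V → 𝕜) (k : K) : 𝕜 := g (B.φ k) / ((√(B.weight k) : ℝ) : 𝕜)

/-- `‖g‖_{φ^*} = (∑ |ĝ_k|² d_k^{-1})^{1/2}`; the series converges for every `g ∈ V^*`. -/
def dualNorm (g : V → 𝕜) : ℝ := √(∑' k, ‖B.dualCoeff g k‖ ^ 2)

/-- The best `N`-term approximation error `E_N(v) = inf_{|Λ| = N} ‖v - P_Λ v‖_φ`. -/
def bestError (v : V) (N : ℕ) : ℝ :=
  ⨅ Λ : {Λ : Finset K // Λ.card = N}, B.phiNorm (v - B.proj Λ.1 v)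

end RieszBasis

/-- The measure `ω_d` of the Euclidean unit ball of `ℝ^d`. -/
def unitBallVolume (d : ℕ) : ℝ :=
  (volume (Metric.ball (0 : EuclideanSpace ℝ (Fin d)) 1)).toReal

namespace RieszBasis

variable {d : ℕ} {𝕜 : Type} [RCLike 𝕜] {K : Set (Fin d → ℤ)} {V : Type}
  [NormedAddCommGroup V] [NormedSpace 𝕜 V] (B : RieszBasis 𝕜 K V)

/-- `E_N(v) exp(η ω_d^{-t/d} N^{t/d})`. -/
def gevreyTerm (η t : ℝ) (v : V) (N : ℕ) : ℝ :=
  B.bestError v N *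
    Real.exp (η * unitBallVolume d ^ (-(t / (d : ℝ))) * (N : ℝ) ^ (t / (d : ℝ)))

/-- Membership in the Gevrey sparsity class `𝒜_G^{η,t}`. -/
def MemGevrey (η t : ℝ) (v : V) : Prop := BddAbove (Set.range (B.gevreyTerm η t v))

/-- `‖v‖_{𝒜_G^{η,t}} = sup_N E_N(v) exp(η ω_d^{-t/d} N^{t/d})` (for `v` in the class). -/
def gevreyNorm (η t : ℝ) (v : V) : ℝ := ⨆ N, B.gevreyTerm η t v N

end RieszBasis

section Matrices

variable {d : ℕ} {𝕜 : Type} [RCLike 𝕜] {K : Set (Fin d → ℤ)}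

/-- The stiffness matrix with respect to the normalized basis `d_k^{-1/2} φ_k`:
`a_{ℓ,k} = a(φ_k, φ_ℓ) / √(d_ℓ d_k)`. It maps `(v̂_k √d_k)` to `(⟨Lv, φ_ℓ⟩ / √d_ℓ)`. -/
def stiffness (P : EllipticProblem d) (B : RieszBasis 𝕜 K (P.V 𝕜)) (l k : K) : 𝕜 :=
  P.form (B.φ k) (B.φ l) / ((√(B.weight l) * √(B.weight k) : ℝ) : 𝕜)

/-- The class `𝒟_e(η_L)` with constant `c_L`: `|m_{ℓ,k}| ≤ c_L exp(-η_L |ℓ - k|)`. -/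
def ExpDecay (cL ηL : ℝ) (M : K → K → 𝕜) : Prop :=
  ∀ l k : K, ‖M l k‖ ≤ cL * Real.exp (-ηL * latticeDist l.1 k.1)

/-- The bi-infinite matrix `M` has norm at most `C` as an operator on `ℓ²(𝒦)`. -/
def OpNormLE (M : K → K → 𝕜) (C : ℝ) : Prop :=
  ∀ (S : Finset K) (x y : K → 𝕜),
    ‖∑ l ∈ S, ∑ k ∈ S, conj (y l) * M l k * x k‖
      ≤ C * √(∑ k ∈ S, ‖x k‖ ^ 2) * √(∑ l ∈ S, ‖y l‖ ^ 2)

/-- `M'` is the matrix of the inverse on `ℓ²(𝒦)` of the bounded invertible operator with matrix `M`: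
its columns lie in `ℓ²(𝒦)` and `M` maps the `k`-th of them to the `k`-th unit vector. -/
def IsInverseMatrix (M M' : K → K → 𝕜) : Prop :=
  ∀ k, Memℓp (fun l => M' l k) 2 ∧
    ∀ l, HasSum (fun m => M l m * M' m k) (if l = k then 1 else 0)

/-- `M - M_J`, where `M_J` is the symmetric truncation of `M` to the entries with `|ℓ - k| ≤ J`. -/
def truncationError (M : K → K → 𝕜) (J : ℝ) (l k : K) : 𝕜 :=
  if latticeDist l.1 k.1 ≤ J then 0 else M l k

end Matrices

/-! ### The algorithm -/

/-- The parameters of the algorithm: `C₀` of the dynamic marking, and the constants `C_{A⁻¹}`,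
`η̃_L` that describe the decay of the inverse stiffness matrix in the enrichment step. -/
structure Params where
  C₀ : ℝ
  Cinv : ℝ
  ηinv : ℝ

section Algorithm

variable {d : ℕ} {𝕜 : Type} [RCLike 𝕜] {K : Set (Fin d → ℤ)}
  (P : EllipticProblem d) (B : RieszBasis 𝕜 K (P.V 𝕜)) (p : Params)

/-- The parameters are admissible: `0 < C₀ ≤ (1/4) √(α_*/α^*) β_*/β^*`, and
`‖A⁻¹ - (A⁻¹)_J‖ ≤ C_{A⁻¹} exp(-η̃_L J)` for all `J ≥ 0`. -/
structure Params.Admissible : Prop where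
  C₀_pos : 0 < p.C₀
  C₀_le : p.C₀ ≤ 1 / 4 * √(P.αLo / P.αHi) * (B.βLo / B.βHi)
  Cinv_pos : 0 < p.Cinv
  ηinv_pos : 0 < p.ηinv
  inv_decay : ∀ M' : K → K → 𝕜, IsInverseMatrix (stiffness P B) M' → ∀ J : ℝ, 0 ≤ J →
    OpNormLE (truncationError M' J) (p.Cinv * Real.exp (-p.ηinv * J))

/-- The Galerkin solution in `V_Λ`. -/
def IsGalerkin (f : P.V 𝕜 →L⋆[𝕜] 𝕜) (Λ : Finset K) (w : P.V 𝕜) : Prop :=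
  w ∈ B.subspace Λ ∧ ∀ v ∈ B.subspace Λ, P.form w v = f v

/-- The bulk criterion `∑_{k ∈ M} |R̂_k|² ≥ θ² ∑_k |R̂_k|²` for the functional `r`. -/
def BulkCriterion (r : P.V 𝕜 → 𝕜) (θ : ℝ) (M : Finset K) : Prop :=
  θ ^ 2 * B.dualNorm r ^ 2 ≤ ∑ k ∈ M, ‖B.dualCoeff r k‖ ^ 2

/-- A possible output of Dörfler's marking: a set of minimal cardinality with the bulk criterion. -/
def IsDoerfler (r : P.V 𝕜 → 𝕜) (θ : ℝ) (M : Finset K) : Prop :=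
  BulkCriterion P B r θ M ∧ ∀ M' : Finset K, BulkCriterion P B r θ M' → M.card ≤ M'.card

/-- The dynamic marking parameter `θ = (1 - C₀² ‖r‖² / ‖r₀‖²)^{1/2}`, `r₀ = f`. -/
def theta (f : P.V 𝕜 →L⋆[𝕜] 𝕜) (w : P.V 𝕜) : ℝ :=
  √(1 - p.C₀ ^ 2 * B.dualNorm (P.residual f w) ^ 2 / B.dualNorm f ^ 2)

/-- The smallest `J ≥ 0` with `C_{A⁻¹} exp(-η̃_L J) ≤ √((1 - θ²) / (α_* α^*))`. -/
def minRadius (θ : ℝ) : ℝ :=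
  max 0 (-(1 / p.ηinv) * Real.log (√((1 - θ ^ 2) / (P.αLo * P.αHi)) / p.Cinv))

/-- One pass through the loop: from `(Λ, w)`, with `w` the current iterate, to `(Λ', w')`.
The marked set is enriched by all indices at distance at most `J`, where `J` is the smallest
possible radius up to a rounding `δ ∈ [0,1)`, and `w'` is the Galerkin solution in `V_Λ'`. -/
def IsStep (f : P.V 𝕜 →L⋆[𝕜] 𝕜) (Λ : Finset K) (w : P.V 𝕜) (Λ' : Finset K) (w' : P.V 𝕜) : Prop :=
  ∃ (M : Finset K) (δ : ℝ),
    IsDoerfler P B (P.residual f w) (theta P B p f w) M ∧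
    0 ≤ δ ∧ δ < 1 ∧
    (∀ k : K, k ∈ Λ' ↔ k ∈ Λ ∨
      ∃ l ∈ M, latticeDist k.1 l.1 ≤ minRadius P p (theta P B p f w) + δ) ∧
    IsGalerkin P B f Λ' w'

/-- A complete run of DYN-GAL with tolerance `ε`: it starts from `Λ₀ = ∅`, `u₀ = 0`, makes the passes
`0, …, n`, and stops at the first iterate `u_{n+1}`, `n + 1 ≥ 1`, whose residual is at most
`ε ‖r₀‖`. -/
structure IsRun (f : P.V 𝕜 →L⋆[𝕜] 𝕜) (ε : ℝ) (n : ℕ) (Λ : ℕ → Finset K) (w : ℕ → P.V 𝕜) :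
    Prop where
  init_set : Λ 0 = ∅
  init_iterate : w 0 = 0
  step : ∀ k ≤ n, IsStep P B p f (Λ k) (w k) (Λ (k + 1)) (w (k + 1))
  continue_loop : ∀ k < n, ε * B.dualNorm f < B.dualNorm (P.residual f (w (k + 1)))
  terminate : B.dualNorm (P.residual f (w (n + 1))) ≤ ε * B.dualNorm f

end Algorithm

/-! ### Arithmetic cost of linear solvers, workload -/

/-- Operands of an arithmetic operation in the solution of a linear system `M x = g` with index
set `ι`: an entry of `M`, an entry of `g`, a rational constant, or an earlier result. -/
inductive Operand (ι : Type) where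
  | entry (i j : ι)
  | rhs (i : ι)
  | const (q : ℚ)
  | result (n : ℕ)

/-- Arithmetic operations. -/
inductive Instr (ι : Type) where
  | add (x y : Operand ι)
  | sub (x y : Operand ι)
  | mul (x y : Operand ι)
  | div (x y : Operand ι)
  | sqrt (x : Operand ι)
  | conj (x : Operand ι)

/-- A sequence of arithmetic operations, with the places where the solution is found. -/
structure ArithProgram (ι : Type) where
  code : List (Instr ι)
  out : ι → Operand ι

section Cost

variable {𝕜 : Type} [RCLike 𝕜] {ι : Type}

/-- Value of an operand, given the list `mem` of earlier results. -/
def Operand.eval (M : ι → ι → 𝕜) (g : ι → 𝕜) (mem : List 𝕜) : Operand ι → 𝕜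
  | .entry i j => M i j
  | .rhs i => g i
  | .const q => (q : 𝕜)
  | .result n => mem.getD n 0

/-- Result of one operation. -/
def Instr.eval (M : ι → ι → 𝕜) (g : ι → 𝕜) (mem : List 𝕜) : Instr ι → 𝕜
  | .add x y => x.eval M g mem + y.eval M g mem
  | .sub x y => x.eval M g mem - y.eval M g mem
  | .mul x y => x.eval M g mem * y.eval M g mem
  | .div x y => x.eval M g mem / y.eval M g mem
  | .sqrt x => ((√(RCLike.re (x.eval M g mem)) : ℝ) : 𝕜)
  | .conj x => (starRingEnd 𝕜) (x.eval M g mem)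

/-- The results of all operations of a program, in order of execution. -/
def ArithProgram.exec (A : ArithProgram ι) (M : ι → ι → 𝕜) (g : ι → 𝕜) : List 𝕜 :=
  A.code.foldl (fun mem c => mem ++ [c.eval M g mem]) []

/-- The vector computed by a program. -/
def ArithProgram.output (A : ArithProgram ι) (M : ι → ι → 𝕜) (g : ι → 𝕜) (i : ι) : 𝕜 :=
  (A.out i).eval M g (A.exec M g)

/-- The number of arithmetic operations. -/
def ArithProgram.cost (A : ArithProgram ι) : ℕ := A.code.length

end Cost

section Workload

variable {d : ℕ} {𝕜 : Type} [RCLike 𝕜] {K : Set (Fin d → ℤ)}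
  (P : EllipticProblem d) (B : RieszBasis 𝕜 K (P.V 𝕜))

/-- A solver for the Galerkin systems: the sequence of operations that it executes on the system
with index set `Λ` and right-hand side `g`. -/
abbrev Solver (𝕜 : Type) (K : Set (Fin d → ℤ)) : Type :=
  (Λ : Finset K) → (Λ → 𝕜) → ArithProgram Λ

/-- The solver solves all systems `A_Λ x = g`, with at most `C |Λ|` arithmetic operations. -/
def IsLinearCostSolver (s : Solver 𝕜 K) (C : ℝ) : Prop :=
  ∀ (Λ : Finset K) (g : Λ → 𝕜),
    (∀ l : Λ, ∑ k : Λ, stiffness P B l k *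
      (s Λ g).output (fun i j : Λ => stiffness P B i j) g k = g l) ∧
    ((s Λ g).cost : ℝ) ≤ C * Λ.card

/-- The workload of a run with passes `0, …, n`: the work to find (arithmetic operations of the
solver) and to store (one unit per coefficient) each of the iterates `u_1, …, u_{n+1}`. -/
def workload (s : Solver 𝕜 K) (f : P.V 𝕜 →L⋆[𝕜] 𝕜) (n : ℕ) (Λ : ℕ → Finset K) : ℝ :=
  ∑ k ∈ Finset.range (n + 1),
    (((s (Λ (k + 1)) fun l => B.dualCoeff f l).cost : ℝ) + (Λ (k + 1)).card)

end Workload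

end DynGal

end

/-!
In the coordinates of the normalized Riesz basis the problem becomes `A U = F` with an elliptic
operator `A` on `ℓ²` whose matrix decays exponentially away from the diagonal. Since a marked set
carries the fraction `θ_n` of the residual `r_n` and `1 - θ_n²` is of the order of `‖r_n‖²`, the
energy of the error contracts by a factor bounded away from `1`, so that `O(log 1/ε)` passes
suffice.

The marked sets are bounded uniformly in the pass. As long as `‖r_n‖ ≥ ε ‖f‖`, a finitely supported
vector within `C₀ ε² ‖f‖` of `r_n` is enough to know how large a minimal marked set can be. Such a
vector comes from a Richardson iteration for the Galerkin problem on `Λ_n`, started from a sparse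
approximation of `U`, in which `A` is replaced by its truncation to a band of width `O(log 1/ε)`:
its support is polylogarithmic in `1/ε` whatever the set `Λ_n` is. The radius of the enrichment is
also `O(log 1/ε)`, so the active sets and the workload are polylogarithmic in `1/ε`, and the loss
of a power of the logarithm is absorbed by lowering the Gevrey exponent `t`.
-/

noncomputable section

namespace DynGal

open scoped lp

theorem integrable_ofReal_mul_inner {α E 𝕜 : Type*} [RCLike 𝕜] [NormedAddCommGroup E]
    [InnerProductSpace 𝕜 E] [MeasurableSpace α] {μ : Measure α} {f g : α → E} {c : α → ℝ} {C : ℝ}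
    (hf : MemLp f 2 μ) (hg : MemLp g 2 μ) (hc : AEMeasurable c μ) (hC : ∀ᵐ x ∂μ, ‖c x‖ ≤ C) :
    Integrable (fun x => (c x : 𝕜) * inner 𝕜 (g x) (f x)) μ := by
  have integrable_inner : Integrable (fun x => inner 𝕜 (g x) (f x)) μ := by
    refine (L2.integrable_inner (𝕜 := 𝕜) (hg.toLp g) (hf.toLp f)).congr ?_
    filter_upwards [hg.coeFn_toLp, hf.coeFn_toLp] with x hgx hfx
    rw [hgx, hfx]
  refine integrable_inner.bdd_mul (c := C)
    (RCLike.measurable_ofReal.comp_aemeasurable hc).aestronglyMeasurable ?_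
  filter_upwards [hC] with x hx
  rwa [RCLike.norm_ofReal]

theorem integral_norm_mul_norm_eq_inner {α E : Type*} [NormedAddCommGroup E] [MeasurableSpace α]
    {μ : Measure α} (f g : Lp E 2 μ) :
    ∫ x, ‖f x‖ * ‖g x‖ ∂μ =
      inner ℝ ((Lp.memLp f).norm.toLp fun x => ‖f x‖) ((Lp.memLp g).norm.toLp fun x => ‖g x‖) := by
  rw [L2.inner_def]
  refine integral_congr_ae ?_
  filter_upwards [(Lp.memLp f).norm.coeFn_toLp, (Lp.memLp g).norm.coeFn_toLp] with x hf hg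
  rw [hf, hg, RCLike.inner_apply, conj_trivial, mul_comm]

theorem norm_toLp_norm {α E : Type*} [NormedAddCommGroup E] [MeasurableSpace α]
    {μ : Measure α} (f : Lp E 2 μ) : ‖(Lp.memLp f).norm.toLp fun x => ‖f x‖‖ = ‖f‖ := by
  rw [Lp.norm_toLp, eLpNorm_norm, ← Lp.norm_def]

theorem integral_norm_mul_norm_le {α E : Type*} [NormedAddCommGroup E] [MeasurableSpace α]
    {μ : Measure α} (f g : Lp E 2 μ) : ∫ x, ‖f x‖ * ‖g x‖ ∂μ ≤ ‖f‖ * ‖g‖ := by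
  rw [integral_norm_mul_norm_eq_inner, ← norm_toLp_norm f, ← norm_toLp_norm g]
  exact real_inner_le_norm _ _

theorem integral_norm_sq_eq {α E : Type*} [NormedAddCommGroup E] [MeasurableSpace α]
    {μ : Measure α} (f : Lp E 2 μ) : ∫ x, ‖f x‖ ^ 2 ∂μ = ‖f‖ ^ 2 := by
  simp only [sq, integral_norm_mul_norm_eq_inner, real_inner_self_eq_norm_mul_norm, norm_toLp_norm]

namespace EllipticProblem

variable {d : ℕ} (P : EllipticProblem d) {𝕜 : Type} [RCLike 𝕜]

theorem measurableSet_Ω : MeasurableSet P.Ω := by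
  have Ω_eq : P.Ω = ⋂ i, (fun x : EuclideanSpace ℝ (Fin d) => x i) ⁻¹' Set.Ioo (P.a i) (P.b i) := by
    ext x
    simp [Ω]
  rw [Ω_eq]
  exact MeasurableSet.iInter fun i =>
    measurableSet_Ioo.preimage (EuclideanSpace.proj (𝕜 := ℝ) i).continuous.measurable

theorem αLo_pos : 0 < P.αLo := lt_min P.νLo_pos P.σLo_pos

theorem αLo_le_αHi : P.αLo ≤ P.αHi := by
  have midpoint_mem :
      (WithLp.toLp 2 fun i => (P.a i + P.b i) / 2 : EuclideanSpace ℝ (Fin d)) ∈ P.Ω :=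
    fun i => ⟨left_lt_add_div_two.2 (P.a_lt_b i), add_div_two_lt_right.2 (P.a_lt_b i)⟩
  obtain ⟨hlo, hhi⟩ := P.ν_bounds _ midpoint_mem
  exact (min_le_left _ _).trans ((hlo.trans hhi).trans (le_max_left _ _))

theorem αHi_pos : 0 < P.αHi := P.αLo_pos.trans_le P.αLo_le_αHi

theorem ae_ν_mem_Icc : ∀ᵐ x ∂P.μ, P.ν x ∈ Set.Icc P.αLo P.αHi := by
  filter_upwards [ae_restrict_mem P.measurableSet_Ω] with x hx
  exact ⟨(min_le_left _ _).trans (P.ν_bounds x hx).1, (P.ν_bounds x hx).2.trans (le_max_left _ _)⟩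

theorem ae_σ_mem_Icc : ∀ᵐ x ∂P.μ, P.σ x ∈ Set.Icc P.αLo P.αHi := by
  filter_upwards [ae_restrict_mem P.measurableSet_Ω] with x hx
  exact ⟨(min_le_right _ _).trans (P.σ_bounds x hx).1, (P.σ_bounds x hx).2.trans (le_max_right _ _)⟩

theorem norm_le_αHi {c : ℝ} (hc : c ∈ Set.Icc P.αLo P.αHi) : ‖c‖ ≤ P.αHi := by
  rw [Real.norm_of_nonneg (P.αLo_pos.le.trans hc.1)]
  exact hc.2

theorem integrable_ν_mul_inner_snd (U W : Lp (Jet 𝕜 d) 2 P.μ) :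
    Integrable (fun x => (P.ν x : 𝕜) * inner 𝕜 (W x).snd (U x).snd) P.μ :=
  have memLp_snd (U : Lp (Jet 𝕜 d) 2 P.μ) : MemLp (fun x => (U x).snd) 2 P.μ :=
    (WithLp.sndL 2 𝕜 𝕜 (EuclideanSpace 𝕜 (Fin d))).comp_memLp' (Lp.memLp U)
  integrable_ofReal_mul_inner (memLp_snd U) (memLp_snd W) P.ν_meas
    (P.ae_ν_mem_Icc.mono fun _ => P.norm_le_αHi)

theorem integrable_σ_mul_inner_fst (U W : Lp (Jet 𝕜 d) 2 P.μ) :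
    Integrable (fun x => (P.σ x : 𝕜) * inner 𝕜 (W x).fst (U x).fst) P.μ :=
  have memLp_fst (U : Lp (Jet 𝕜 d) 2 P.μ) : MemLp (fun x => (U x).fst) 2 P.μ :=
    (WithLp.fstL 2 𝕜 𝕜 (EuclideanSpace 𝕜 (Fin d))).comp_memLp' (Lp.memLp U)
  integrable_ofReal_mul_inner (memLp_fst U) (memLp_fst W) P.σ_meas
    (P.ae_σ_mem_Icc.mono fun _ => P.norm_le_αHi)

/-- The integrand `ν(x) ∇u(x) · conj ∇v(x) + σ(x) u(x) conj v(x)` of the form `a(u,v)`, as a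
function of the point `x` and of the jets of `u` and `v` there. -/
def formDensity (x : EuclideanSpace ℝ (Fin d)) (U W : Jet 𝕜 d) : 𝕜 :=
  (P.ν x : 𝕜) * inner 𝕜 W.snd U.snd + (P.σ x : 𝕜) * inner 𝕜 W.fst U.fst

theorem integrable_formDensity (U W : Lp (Jet 𝕜 d) 2 P.μ) :
    Integrable (fun x => P.formDensity x (U x) (W x)) P.μ :=
  (P.integrable_ν_mul_inner_snd U W).add (P.integrable_σ_mul_inner_fst U W)

theorem form_eq_integral (u v : P.V 𝕜) :
    P.form u v = ∫ x, P.formDensity x ((u : Lp (Jet 𝕜 d) 2 P.μ) x)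
      ((v : Lp (Jet 𝕜 d) 2 P.μ) x) ∂P.μ :=
  (integral_add (P.integrable_ν_mul_inner_snd _ _) (P.integrable_σ_mul_inner_fst _ _)).symm

theorem norm_formDensity_le {x : EuclideanSpace ℝ (Fin d)} (hν : P.ν x ∈ Set.Icc P.αLo P.αHi)
    (hσ : P.σ x ∈ Set.Icc P.αLo P.αHi) (U W : Jet 𝕜 d) :
    ‖P.formDensity x U W‖ ≤ P.αHi * (‖U‖ * ‖W‖) := by
  have cauchy_schwarz : ‖W.snd‖ * ‖U.snd‖ + ‖W.fst‖ * ‖U.fst‖ ≤ ‖U‖ * ‖W‖ := by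
    refine le_of_sq_le_sq ?_ (by positivity)
    rw [mul_pow, WithLp.prod_norm_sq_eq_of_L2, WithLp.prod_norm_sq_eq_of_L2]
    linarith [sq_nonneg (‖W.snd‖ * ‖U.fst‖ - ‖W.fst‖ * ‖U.snd‖)]
  calc ‖P.formDensity x U W‖
      ≤ ‖P.ν x‖ * ‖inner 𝕜 W.snd U.snd‖ + ‖P.σ x‖ * ‖inner 𝕜 W.fst U.fst‖ := by
        refine (norm_add_le _ _).trans_eq ?_
        rw [norm_mul, norm_mul, RCLike.norm_ofReal, RCLike.norm_ofReal, Real.norm_eq_abs,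
          Real.norm_eq_abs]
    _ ≤ P.αHi * (‖W.snd‖ * ‖U.snd‖) + P.αHi * (‖W.fst‖ * ‖U.fst‖) := by
        have := P.αHi_pos
        gcongr
        exacts [P.norm_le_αHi hν, norm_inner_le_norm _ _, P.norm_le_αHi hσ, norm_inner_le_norm _ _]
    _ ≤ P.αHi * (‖U‖ * ‖W‖) := by
        rw [← mul_add]
        exact mul_le_mul_of_nonneg_left cauchy_schwarz P.αHi_pos.le

theorem αLo_mul_norm_sq_le_re_formDensity {x : EuclideanSpace ℝ (Fin d)} (hν : P.αLo ≤ P.ν x)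
    (hσ : P.αLo ≤ P.σ x) (U : Jet 𝕜 d) :
    P.αLo * ‖U‖ ^ 2 ≤ RCLike.re (P.formDensity x U U) := by
  rw [formDensity, map_add, RCLike.re_ofReal_mul, RCLike.re_ofReal_mul, inner_self_eq_norm_sq,
    inner_self_eq_norm_sq, WithLp.prod_norm_sq_eq_of_L2, mul_add, add_comm]
  gcongr

theorem conj_form (u v : P.V 𝕜) : conj (P.form u v) = P.form v u := by
  simp only [form_eq_integral, formDensity, ← integral_conj, map_add, map_mul, RCLike.conj_ofReal,
    inner_conj_symm]

theorem form_add_left (u u' v : P.V 𝕜) : P.form (u + u') v = P.form u v + P.form u' v := by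
  simp only [form_eq_integral]
  rw [← integral_add (P.integrable_formDensity _ _) (P.integrable_formDensity _ _)]
  refine integral_congr_ae ?_
  filter_upwards [Lp.coeFn_add (u : Lp (Jet 𝕜 d) 2 P.μ) u'] with x hx
  simp only [formDensity, Submodule.coe_add, hx, Pi.add_apply, WithLp.add_fst, WithLp.add_snd,
    inner_add_right]
  ring

theorem form_smul_left (c : 𝕜) (u v : P.V 𝕜) : P.form (c • u) v = c * P.form u v := by
  simp only [form_eq_integral]
  rw [← integral_const_mul]
  refine integral_congr_ae ?_
  filter_upwards [Lp.coeFn_smul c (u : Lp (Jet 𝕜 d) 2 P.μ)] with x hx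
  simp only [formDensity, Submodule.coe_smul, hx, Pi.smul_apply, WithLp.smul_fst, WithLp.smul_snd,
    inner_smul_right]
  ring

theorem norm_form_le (u v : P.V 𝕜) : ‖P.form u v‖ ≤ P.αHi * ‖u‖ * ‖v‖ := by
  calc ‖P.form u v‖
      ≤ ∫ x, P.αHi * (‖(u : Lp (Jet 𝕜 d) 2 P.μ) x‖ * ‖(v : Lp (Jet 𝕜 d) 2 P.μ) x‖) ∂P.μ := by
        rw [form_eq_integral]
        refine norm_integral_le_of_norm_le
          (((Lp.memLp _).norm.integrable_mul (Lp.memLp _).norm).const_mul _) ?_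
        filter_upwards [P.ae_ν_mem_Icc, P.ae_σ_mem_Icc] with x hν hσ
        exact P.norm_formDensity_le hν hσ _ _
    _ ≤ P.αHi * ‖u‖ * ‖v‖ := by
        rw [integral_const_mul, mul_assoc]
        exact mul_le_mul_of_nonneg_left (integral_norm_mul_norm_le _ _) P.αHi_pos.le

theorem αLo_mul_norm_sq_le_re_form (v : P.V 𝕜) : P.αLo * ‖v‖ ^ 2 ≤ RCLike.re (P.form v v) := by
  calc P.αLo * ‖v‖ ^ 2
      = ∫ x, P.αLo * ‖(v : Lp (Jet 𝕜 d) 2 P.μ) x‖ ^ 2 ∂P.μ := by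
        rw [integral_const_mul, integral_norm_sq_eq, Submodule.coe_norm]
    _ ≤ ∫ x, RCLike.re (P.formDensity x ((v : Lp (Jet 𝕜 d) 2 P.μ) x)
          ((v : Lp (Jet 𝕜 d) 2 P.μ) x)) ∂P.μ := by
        refine integral_mono_ae ((Lp.memLp _).norm.integrable_sq.const_mul _)
          (P.integrable_formDensity _ _).re ?_
        filter_upwards [P.ae_ν_mem_Icc, P.ae_σ_mem_Icc] with x hν hσ
        exact P.αLo_mul_norm_sq_le_re_formDensity hν.1 hσ.1 _
    _ = RCLike.re (P.form v v) := by
        rw [form_eq_integral]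
        exact integral_re (P.integrable_formDensity _ _)

theorem isClosed_V : IsClosed (P.V 𝕜 : Set (Lp (Jet 𝕜 d) 2 P.μ)) :=
  Submodule.isClosed_topologicalClosure _

instance : CompleteSpace (P.V 𝕜) := P.isClosed_V.completeSpace_coe

/-- The form `a` as a continuous sesquilinear map; its arguments are swapped, so that, following
Mathlib's convention, it is conjugate linear in the first one. -/
def formL : P.V 𝕜 →L⋆[𝕜] P.V 𝕜 →L[𝕜] 𝕜 :=
  LinearMap.mkContinuous₂
    (LinearMap.mk₂'ₛₗ (starRingEnd 𝕜) (RingHom.id 𝕜) (fun v u => P.form u v)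
      (fun v v' u => by
        rw [← P.conj_form, P.form_add_left, map_add, P.conj_form, P.conj_form])
      (fun c v u => by rw [← P.conj_form, P.form_smul_left, map_mul, P.conj_form, smul_eq_mul])
      (fun v u u' => P.form_add_left u u' v) (fun c v u => P.form_smul_left c u v))
    P.αHi fun v u => (P.norm_form_le u v).trans_eq (mul_right_comm _ _ _)

theorem formL_apply (u v : P.V 𝕜) : P.formL v u = P.form u v := rfl

/-- The operator `V → V` that represents the form `a`. -/
def operator : P.V 𝕜 →L[𝕜] P.V 𝕜 := InnerProductSpace.continuousLinearMapOfBilin P.formL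

theorem inner_operator (u v : P.V 𝕜) : inner 𝕜 v (P.operator u) = P.form u v := by
  rw [← inner_conj_symm, operator, InnerProductSpace.continuousLinearMapOfBilin_apply, formL_apply,
    P.conj_form]

end EllipticProblem

section Truncation

variable {ι 𝕜 : Type*} [RCLike 𝕜] [DecidableEq ι]

/-- The restriction of a square summable sequence to a finite set of indices. -/
def trunc (S : Finset ι) : ℓ²(ι, 𝕜) →L[𝕜] ℓ²(ι, 𝕜) :=
  ∑ k ∈ S, (lp.singleContinuousLinearMap 𝕜 (fun _ : ι => 𝕜) 2 k).comp
    (lp.evalCLM 𝕜 (fun _ : ι => 𝕜) 2 k)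

theorem trunc_eq_sum_single (S : Finset ι) (x : ℓ²(ι, 𝕜)) :
    trunc S x = ∑ k ∈ S, lp.single 2 k (x k) := by
  rw [trunc, sum_apply]
  rfl

theorem trunc_apply (S : Finset ι) (x : ℓ²(ι, 𝕜)) (k : ι) :
    trunc S x k = if k ∈ S then x k else 0 := by
  simp only [trunc_eq_sum_single, lp.coeFn_sum, Finset.sum_apply, lp.coeFn_single,
    Finset.sum_pi_single]

theorem trunc_trunc_of_subset {S T : Finset ι} (h : S ⊆ T) (x : ℓ²(ι, 𝕜)) :
    trunc T (trunc S x) = trunc S x := by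
  ext k
  by_cases hk : k ∈ S
  · simp [trunc_apply, hk, h hk]
  · simp [trunc_apply, hk]

theorem trunc_trunc (S : Finset ι) (x : ℓ²(ι, 𝕜)) : trunc S (trunc S x) = trunc S x :=
  trunc_trunc_of_subset subset_rfl x

theorem trunc_comm (S T : Finset ι) (x : ℓ²(ι, 𝕜)) :
    trunc S (trunc T x) = trunc T (trunc S x) := by
  ext k
  simp only [trunc_apply]
  split_ifs <;> rfl

theorem trunc_eq_self_of_subset {S T : Finset ι} (h : S ⊆ T) {x : ℓ²(ι, 𝕜)}
    (hx : trunc S x = x) : trunc T x = x := by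
  rw [← hx, trunc_trunc_of_subset h]

theorem inner_trunc_left (S : Finset ι) (x y : ℓ²(ι, 𝕜)) :
    inner 𝕜 (trunc S x) y = inner 𝕜 x (trunc S y) := by
  rw [lp.inner_eq_tsum, lp.inner_eq_tsum]
  refine tsum_congr fun k => ?_
  simp only [trunc_apply]
  split_ifs <;> simp

theorem norm_sq_trunc (S : Finset ι) (x : ℓ²(ι, 𝕜)) :
    ‖trunc S x‖ ^ 2 = ∑ k ∈ S, ‖x k‖ ^ 2 := by
  have norm_sum_single := lp.norm_sum_single (E := fun _ : ι => 𝕜) (p := 2) (by norm_num) x S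
  simpa [trunc_eq_sum_single] using norm_sum_single

theorem norm_sq_eq_trunc_add (S : Finset ι) (x : ℓ²(ι, 𝕜)) :
    ‖x‖ ^ 2 = ‖trunc S x‖ ^ 2 + ‖x - trunc S x‖ ^ 2 := by
  have orthogonal : inner 𝕜 (trunc S x) (x - trunc S x) = 0 := by
    rw [inner_trunc_left, map_sub, trunc_trunc, sub_self, inner_zero_right]
  have pythagoras := norm_add_sq_eq_norm_sq_add_norm_sq_of_inner_eq_zero _ _ orthogonal
  rwa [add_sub_cancel, ← sq, ← sq, ← sq] at pythagoras

theorem norm_trunc_le (S : Finset ι) (x : ℓ²(ι, 𝕜)) : ‖trunc S x‖ ≤ ‖x‖ := by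
  refine le_of_sq_le_sq ?_ (norm_nonneg _)
  rw [norm_sq_eq_trunc_add S x]
  exact le_add_of_nonneg_right (sq_nonneg _)

theorem norm_sub_trunc_le (S : Finset ι) (x : ℓ²(ι, 𝕜)) : ‖x - trunc S x‖ ≤ ‖x‖ := by
  refine le_of_sq_le_sq ?_ (norm_nonneg _)
  rw [norm_sq_eq_trunc_add S x]
  exact le_add_of_nonneg_left (sq_nonneg _)

theorem norm_sub_trunc_le_norm_sub (S : Finset ι) (x : ℓ²(ι, 𝕜)) {y : ℓ²(ι, 𝕜)}
    (hy : trunc S y = y) : ‖x - trunc S x‖ ≤ ‖x - y‖ := by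
  have := norm_sub_trunc_le S (x - y)
  rwa [map_sub, hy, sub_sub_sub_cancel_right] at this

end Truncation

section Elliptic

variable {𝕜 E : Type*} [RCLike 𝕜] [NormedAddCommGroup E] [InnerProductSpace 𝕜 E]

/-- The square of the energy norm of the operator `A`. -/
def energy (A : E →L[𝕜] E) (x : E) : ℝ := RCLike.re (inner 𝕜 x (A x))

/-- A symmetric operator with spectrum in `[m, M]`, `0 < m ≤ M`. -/
structure IsElliptic (A : E →L[𝕜] E) (m M : ℝ) : Prop where
  symm : (A : E →ₗ[𝕜] E).IsSymmetric
  m_pos : 0 < m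
  m_le_M : m ≤ M
  lower : ∀ x, m * ‖x‖ ^ 2 ≤ energy A x
  upper : ∀ x, energy A x ≤ M * ‖x‖ ^ 2

theorem energy_le_norm_mul (A : E →L[𝕜] E) (x : E) : energy A x ≤ ‖x‖ * ‖A x‖ :=
  (RCLike.re_le_norm _).trans (norm_inner_le_norm _ _)

namespace IsElliptic

variable {A : E →L[𝕜] E} {m M : ℝ}

theorem M_pos (h : IsElliptic A m M) : 0 < M := h.m_pos.trans_le h.m_le_M

theorem one_le_div (h : IsElliptic A m M) : 1 ≤ M / m := (_root_.one_le_div h.m_pos).2 h.m_le_M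

theorem norm_ofReal_inv (h : IsElliptic A m M) : ‖((M⁻¹ : ℝ) : 𝕜)‖ = M⁻¹ := by
  rw [RCLike.norm_ofReal, abs_of_pos (inv_pos.2 h.M_pos)]

theorem energy_nonneg (h : IsElliptic A m M) (x : E) : 0 ≤ energy A x :=
  (mul_nonneg h.m_pos.le (sq_nonneg _)).trans (h.lower x)

theorem energy_sub (h : IsElliptic A m M) (x y : E) :
    energy A (x - y) = energy A x - 2 * RCLike.re (inner 𝕜 y (A x)) + energy A y := by
  have re_inner_comm : RCLike.re (inner 𝕜 x (A y)) = RCLike.re (inner 𝕜 y (A x)) := by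
    rw [← h.symm.apply_clm, ← inner_conj_symm, RCLike.conj_re]
  simp only [energy, map_sub, inner_sub_left, inner_sub_right, re_inner_comm]
  ring

/-- A gradient step of length `1 / M` in a direction `z` along which the residual `A x` has the
component `‖z‖²` lowers the energy by at least `‖z‖² / M`. -/
theorem energy_sub_smul_le (h : IsElliptic A m M) (x z : E)
    (hz : RCLike.re (inner 𝕜 z (A x)) = ‖z‖ ^ 2) :
    energy A (x - ((M⁻¹ : ℝ) : 𝕜) • z) ≤ energy A x - ‖z‖ ^ 2 / M := by
  have hM := h.M_pos
  have step_energy := h.upper (((M⁻¹ : ℝ) : 𝕜) • z)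
  rw [norm_smul, h.norm_ofReal_inv] at step_energy
  calc energy A (x - ((M⁻¹ : ℝ) : 𝕜) • z)
      = energy A x - 2 * (M⁻¹ * ‖z‖ ^ 2) + energy A (((M⁻¹ : ℝ) : 𝕜) • z) := by
        rw [h.energy_sub, inner_smul_left, RCLike.conj_ofReal, RCLike.re_ofReal_mul, hz]
    _ ≤ energy A x - 2 * (M⁻¹ * ‖z‖ ^ 2) + M * (M⁻¹ * ‖z‖) ^ 2 := by gcongr
    _ = energy A x - ‖z‖ ^ 2 / M := by field_simp; ring

theorem norm_apply_sq_le (h : IsElliptic A m M) (x : E) : ‖A x‖ ^ 2 ≤ M * energy A x := by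
  have gradient_step := h.energy_sub_smul_le x (A x) (inner_self_eq_norm_sq (𝕜 := 𝕜) _)
  rw [← div_le_iff₀' h.M_pos]
  linarith [h.energy_nonneg (x - ((M⁻¹ : ℝ) : 𝕜) • A x)]

theorem norm_apply_le (h : IsElliptic A m M) (x : E) : ‖A x‖ ≤ M * ‖x‖ := by
  refine le_of_sq_le_sq ?_ (mul_nonneg h.M_pos.le (norm_nonneg _))
  calc ‖A x‖ ^ 2 ≤ M * energy A x := h.norm_apply_sq_le x
    _ ≤ M * (M * ‖x‖ ^ 2) := mul_le_mul_of_nonneg_left (h.upper x) h.M_pos.le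
    _ = (M * ‖x‖) ^ 2 := by ring

theorem mul_norm_le_norm_apply (h : IsElliptic A m M) (x : E) : m * ‖x‖ ≤ ‖A x‖ := by
  obtain rfl | hx := eq_or_ne x 0
  · simp
  · refine le_of_mul_le_mul_left ?_ (norm_pos_iff.2 hx)
    linarith [(h.lower x).trans (energy_le_norm_mul A x)]

theorem mul_energy_le_norm_apply_sq (h : IsElliptic A m M) (x : E) :
    m * energy A x ≤ ‖A x‖ ^ 2 := by
  calc m * energy A x ≤ m * (‖x‖ * ‖A x‖) :=
        mul_le_mul_of_nonneg_left (energy_le_norm_mul A x) h.m_pos.le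
    _ = m * ‖x‖ * ‖A x‖ := by ring
    _ ≤ ‖A x‖ * ‖A x‖ := by gcongr; exact h.mul_norm_le_norm_apply x
    _ = ‖A x‖ ^ 2 := (sq _).symm

theorem norm_sub_smul_sq_le (h : IsElliptic A m M) (x z : E)
    (hz : RCLike.re (inner 𝕜 x z) = energy A x) (hz' : ‖z‖ ≤ ‖A x‖) :
    ‖x - ((M⁻¹ : ℝ) : 𝕜) • z‖ ^ 2 ≤ (1 - m / M) * ‖x‖ ^ 2 := by
  have hM := h.M_pos
  calc ‖x - ((M⁻¹ : ℝ) : 𝕜) • z‖ ^ 2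
      = ‖x‖ ^ 2 - 2 * (M⁻¹ * energy A x) + (M⁻¹) ^ 2 * ‖z‖ ^ 2 := by
        rw [@norm_sub_sq 𝕜, inner_smul_right, RCLike.re_ofReal_mul, hz, norm_smul,
          h.norm_ofReal_inv, mul_pow]
    _ ≤ ‖x‖ ^ 2 - 2 * (M⁻¹ * energy A x) + (M⁻¹) ^ 2 * (M * energy A x) := by
        gcongr
        exact (pow_le_pow_left₀ (norm_nonneg z) hz' 2).trans (h.norm_apply_sq_le x)
    _ = ‖x‖ ^ 2 - M⁻¹ * energy A x := by field_simp; ring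
    _ ≤ ‖x‖ ^ 2 - M⁻¹ * (m * ‖x‖ ^ 2) := by gcongr; exact h.lower x
    _ = (1 - m / M) * ‖x‖ ^ 2 := by ring

end IsElliptic

end Elliptic

section Galerkin

variable {ι 𝕜 : Type*} [RCLike 𝕜] [DecidableEq ι] {A : ℓ²(ι, 𝕜) →L[𝕜] ℓ²(ι, 𝕜)} {m M : ℝ}
  {Λ : Finset ι} {U W : ℓ²(ι, 𝕜)}

theorem IsElliptic.norm_sub_smul_trunc_apply_le (hA : IsElliptic A m M) {x : ℓ²(ι, 𝕜)}
    (hx : trunc Λ x = x) :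
    ‖x - ((M⁻¹ : ℝ) : 𝕜) • trunc Λ (A x)‖ ≤ √(1 - m / M) * ‖x‖ := by
  have contraction := hA.norm_sub_smul_sq_le x (trunc Λ (A x))
    (by rw [← inner_trunc_left, hx, energy]) (norm_trunc_le _ _)
  rw [← Real.sqrt_sq (norm_nonneg x), ← Real.sqrt_mul' _ (sq_nonneg _)]
  exact Real.le_sqrt_of_sq_le contraction

/-- `W` is the Galerkin approximation to `U`, supported in `Λ`, with respect to the operator `A`. -/
structure IsGalerkinSeq (A : ℓ²(ι, 𝕜) →L[𝕜] ℓ²(ι, 𝕜)) (Λ : Finset ι) (U W : ℓ²(ι, 𝕜)) :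
    Prop where
  supp : trunc Λ W = W
  orth : trunc Λ (A (U - W)) = 0

namespace IsGalerkinSeq

theorem energy_le (hW : IsGalerkinSeq A Λ U W) (hA : IsElliptic A m M) {z : ℓ²(ι, 𝕜)}
    (hz : trunc Λ z = z) : energy A (U - W) ≤ energy A (U - z) := by
  have sub_supp : trunc Λ (z - W) = z - W := by rw [map_sub, hz, hW.supp]
  have orthogonal : inner 𝕜 (z - W) (A (U - W)) = 0 := by
    rw [← sub_supp, inner_trunc_left, hW.orth, inner_zero_right]
  rw [← sub_sub_sub_cancel_right U z W, hA.energy_sub (U - W), orthogonal, map_zero]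
  linarith [hA.energy_nonneg (z - W)]

theorem energy_le_mul {W' : ℓ²(ι, 𝕜)} (hW' : IsGalerkinSeq A Λ U W') (hA : IsElliptic A m M)
    (hW : trunc Λ W = W) {S : Finset ι} (hS : S ⊆ Λ) {ρ : ℝ} (hρ : 0 ≤ ρ)
    (hbulk : ρ * ‖A (U - W)‖ ^ 2 ≤ ‖trunc S (A (U - W))‖ ^ 2) :
    energy A (U - W') ≤ (1 - ρ * (m / M)) * energy A (U - W) := by
  have hM := hA.M_pos
  have step_supp : trunc Λ (W + ((M⁻¹ : ℝ) : 𝕜) • trunc S (A (U - W))) =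
      W + ((M⁻¹ : ℝ) : 𝕜) • trunc S (A (U - W)) := by
    rw [map_add, hW, map_smul, trunc_trunc_of_subset hS]
  have step_component : RCLike.re (inner 𝕜 (trunc S (A (U - W))) (A (U - W))) =
      ‖trunc S (A (U - W))‖ ^ 2 := by
    rw [← trunc_trunc S (A (U - W)), inner_trunc_left, trunc_trunc, inner_self_eq_norm_sq]
  calc energy A (U - W')
      ≤ energy A (U - W - ((M⁻¹ : ℝ) : 𝕜) • trunc S (A (U - W))) := by
        rw [sub_sub]
        exact hW'.energy_le hA step_supp
    _ ≤ energy A (U - W) - ‖trunc S (A (U - W))‖ ^ 2 / M := hA.energy_sub_smul_le _ _ step_component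
    _ ≤ energy A (U - W) - ρ * (m * energy A (U - W)) / M := by
        gcongr
        refine le_trans ?_ hbulk
        gcongr
        exact hA.mul_energy_le_norm_apply_sq _
    _ = (1 - ρ * (m / M)) * energy A (U - W) := by ring

theorem norm_sub_le (hW : IsGalerkinSeq A Λ U W) (hA : IsElliptic A m M) :
    ‖U - W‖ ≤ M / m * ‖U‖ := by
  have hm := hA.m_pos
  have hM := hA.M_pos
  have energy_le := hW.energy_le hA (map_zero (trunc Λ))
  rw [sub_zero] at energy_le
  have sq_le : ‖U - W‖ ^ 2 ≤ M / m * ‖U‖ ^ 2 := by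
    rw [div_mul_eq_mul_div, le_div_iff₀' hm]
    exact (hA.lower _).trans (energy_le.trans (hA.upper U))
  refine le_of_sq_le_sq (sq_le.trans ?_) (by positivity)
  rw [mul_pow]
  gcongr
  exact le_self_pow₀ hA.one_le_div two_ne_zero

theorem norm_le (hW : IsGalerkinSeq A Λ U W) (hA : IsElliptic A m M) :
    ‖W‖ ≤ (1 + M / m) * ‖U‖ := by
  linarith [norm_le_norm_add_norm_sub U W, hW.norm_sub_le hA]

theorem norm_apply_sub_sq_le (hW : IsGalerkinSeq A Λ U W) (hA : IsElliptic A m M) :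
    ‖A (U - W)‖ ^ 2 ≤ M / m * ‖A U‖ ^ 2 := by
  have hm := hA.m_pos
  have hM := hA.M_pos
  have energy_le := hW.energy_le hA (map_zero (trunc Λ))
  rw [sub_zero] at energy_le
  calc ‖A (U - W)‖ ^ 2 ≤ M * energy A (U - W) := hA.norm_apply_sq_le _
    _ ≤ M * energy A U := by gcongr
    _ = M / m * (m * energy A U) := by field_simp
    _ ≤ M / m * ‖A U‖ ^ 2 := by gcongr; exact hA.mul_energy_le_norm_apply_sq U

end IsGalerkinSeq

end Galerkin

section Residual

variable {ι 𝕜 : Type*} [RCLike 𝕜] [DecidableEq ι] {A : ℓ²(ι, 𝕜) →L[𝕜] ℓ²(ι, 𝕜)} {m M : ℝ}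
  {Λ : Finset ι} {S : ℕ → Finset ι} {γ : ℝ} {U W : ℓ²(ι, 𝕜)}

/-- The sets `S j` increase, and `A` maps sequences supported in `S j` to sequences supported in
`S (j + 1)`, up to a perturbation of norm `γ`. For an operator with off-diagonal decay, `S (j + 1)`
is a neighbourhood of `S j`. -/
structure IsApproxBanded (A : ℓ²(ι, 𝕜) →L[𝕜] ℓ²(ι, 𝕜)) (S : ℕ → Finset ι) (γ : ℝ) : Prop where
  mono : Monotone S
  norm_sub_trunc_le : ∀ j v, trunc (S j) v = v → ‖A v - trunc (S (j + 1)) (A v)‖ ≤ γ * ‖v‖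

/-- Richardson's iteration for the Galerkin system with index set `Λ`, where the exact solution `U`
is replaced by its truncation to `S 0` and the `j`-th iterate is truncated to `S j`. -/
def sparseRichardson (A : ℓ²(ι, 𝕜) →L[𝕜] ℓ²(ι, 𝕜)) (M : ℝ) (Λ : Finset ι) (S : ℕ → Finset ι)
    (U : ℓ²(ι, 𝕜)) : ℕ → ℓ²(ι, 𝕜)
  | 0 => 0
  | j + 1 => trunc (S (j + 1)) (sparseRichardson A M Λ S U j +
      ((M⁻¹ : ℝ) : 𝕜) • trunc Λ (A (trunc (S 0) U - sparseRichardson A M Λ S U j)))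

/-- The contraction rate of the perturbed Richardson iteration, halfway between the rate
`√(1 - m / M)` of the exact iteration and `1`. -/
def richardsonRate (m M : ℝ) : ℝ := (1 + √(1 - m / M)) / 2

theorem richardsonRate_pos (m M : ℝ) : 0 < richardsonRate m M := by
  rw [richardsonRate]
  positivity

theorem IsElliptic.richardsonRate_lt_one {E : Type*} [NormedAddCommGroup E]
    [InnerProductSpace 𝕜 E] {A : E →L[𝕜] E} (hA : IsElliptic A m M) : richardsonRate m M < 1 := by
  have sqrt_lt_one : √(1 - m / M) < 1 := by
    rw [Real.sqrt_lt' one_pos, one_pow]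
    exact sub_lt_self _ (div_pos hA.m_pos hA.M_pos)
  rw [richardsonRate]
  linarith

theorem trunc_sparseRichardson (j : ℕ) :
    trunc (S j) (sparseRichardson A M Λ S U j) = sparseRichardson A M Λ S U j := by
  cases j with
  | zero => exact map_zero _
  | succ j => exact trunc_trunc _ _

theorem trunc_galerkin_sparseRichardson (j : ℕ) :
    trunc Λ (sparseRichardson A M Λ S U j) = sparseRichardson A M Λ S U j := by
  induction j with
  | zero => exact map_zero _
  | succ j ih => rw [sparseRichardson, trunc_comm, map_add, ih, map_smul, trunc_trunc]

theorem IsApproxBanded.trunc_sub_sparseRichardson (hS : IsApproxBanded A S γ) (j : ℕ) :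
    trunc (S j) (trunc (S 0) U - sparseRichardson A M Λ S U j) =
      trunc (S 0) U - sparseRichardson A M Λ S U j := by
  rw [map_sub, trunc_trunc_of_subset (hS.mono j.zero_le), trunc_sparseRichardson]

/-- The error after a step of the perturbed iteration: the error after a step of the exact one,
the consistency error of the right-hand side, and the truncation error. -/
theorem IsGalerkinSeq.sub_sparseRichardson_succ (hW : IsGalerkinSeq A Λ U W)
    (hS : IsApproxBanded A S γ) (j : ℕ) {x r : ℓ²(ι, 𝕜)}
    (hx : x = sparseRichardson A M Λ S U j) (hr : r = A (trunc (S 0) U - x)) :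
    W - sparseRichardson A M Λ S U (j + 1) =
      ((W - x) - ((M⁻¹ : ℝ) : 𝕜) • trunc Λ (A (W - x)))
        + ((M⁻¹ : ℝ) : 𝕜) • trunc Λ (A (U - trunc (S 0) U))
        + ((M⁻¹ : ℝ) : 𝕜) • trunc Λ (r - trunc (S (j + 1)) r) := by
  have trunc_x : trunc (S (j + 1)) x = x :=
    trunc_eq_self_of_subset (hS.mono j.le_succ) (hx ▸ trunc_sparseRichardson j)
  have residual_eq : trunc Λ r = trunc Λ (A (W - x)) - trunc Λ (A (U - trunc (S 0) U)) := by
    have : r = A (W - x) - A (U - trunc (S 0) U) + A (U - W) := by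
      rw [hr, ← map_sub, ← map_add]
      congr 1
      abel
    rw [this, map_add, map_sub, hW.orth, add_zero]
  rw [sparseRichardson, ← hx, ← hr, map_add, trunc_x, map_smul, map_sub (trunc Λ) r,
    trunc_comm Λ (S (j + 1)), smul_sub, residual_eq, smul_sub]
  abel

theorem IsGalerkinSeq.norm_sub_sparseRichardson_succ_le (hW : IsGalerkinSeq A Λ U W)
    (hA : IsElliptic A m M) (hS : IsApproxBanded A S γ) (j : ℕ) :
    ‖W - sparseRichardson A M Λ S U (j + 1)‖ ≤
      √(1 - m / M) * ‖W - sparseRichardson A M Λ S U j‖ + ‖U - trunc (S 0) U‖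
        + M⁻¹ * (γ * ‖trunc (S 0) U - sparseRichardson A M Λ S U j‖) := by
  have hM := hA.M_pos
  rw [hW.sub_sparseRichardson_succ hS j rfl rfl]
  refine (norm_add₃_le).trans (add_le_add_three ?exact_step ?consistency ?truncation)
  case exact_step =>
    refine hA.norm_sub_smul_trunc_apply_le ?_
    rw [map_sub, hW.supp, trunc_galerkin_sparseRichardson]
  case consistency =>
    rw [norm_smul, hA.norm_ofReal_inv, inv_mul_le_iff₀ hM]
    exact (norm_trunc_le _ _).trans (hA.norm_apply_le _)
  case truncation =>
    rw [norm_smul, hA.norm_ofReal_inv]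
    gcongr
    exact (norm_trunc_le _ _).trans (hS.norm_sub_trunc_le j _ (hS.trunc_sub_sparseRichardson j))

theorem IsGalerkinSeq.norm_trunc_sub_le (hW : IsGalerkinSeq A Λ U W) (hA : IsElliptic A m M)
    (T : Finset ι) (x : ℓ²(ι, 𝕜)) : ‖trunc T U - x‖ ≤ (2 + M / m) * ‖U‖ + ‖W - x‖ := by
  calc ‖trunc T U - x‖ ≤ ‖trunc T U‖ + ‖W‖ + ‖W - x‖ := by
        rw [← sub_add_sub_cancel (trunc T U) W x]
        exact (norm_add_le _ _).trans (by gcongr; exact _root_.norm_sub_le _ _)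
    _ ≤ ‖U‖ + (1 + M / m) * ‖U‖ + ‖W - x‖ := by
        gcongr
        exacts [norm_trunc_le _ _, hW.norm_le hA]
    _ = (2 + M / m) * ‖U‖ + ‖W - x‖ := by ring

theorem le_geometric_of_affine_recurrence {x : ℕ → ℝ} {q b : ℝ} (hq : 0 ≤ q) (hq1 : q < 1)
    (hb : 0 ≤ b) (h : ∀ j, x (j + 1) ≤ q * x j + b) (n : ℕ) :
    x n ≤ q ^ n * x 0 + b / (1 - q) := by
  have one_sub_pos : 0 < 1 - q := by linarith
  induction n with
  | zero => simpa using div_nonneg hb one_sub_pos.le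
  | succ n ih =>
    calc x (n + 1) ≤ q * x n + b := h n
      _ ≤ q * (q ^ n * x 0 + b / (1 - q)) + b := by gcongr
      _ = q ^ (n + 1) * x 0 + b / (1 - q) := by field_simp; ring

theorem IsGalerkinSeq.norm_sub_sparseRichardson_le (hW : IsGalerkinSeq A Λ U W)
    (hA : IsElliptic A m M) (hS : IsApproxBanded A S γ) (hγ : 0 ≤ γ)
    (hγ' : γ ≤ M * (1 - richardsonRate m M)) (n : ℕ) :
    ‖W - sparseRichardson A M Λ S U n‖ ≤ richardsonRate m M ^ n * ((1 + M / m) * ‖U‖) +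
      (‖U - trunc (S 0) U‖ + M⁻¹ * γ * ((2 + M / m) * ‖U‖)) / (1 - richardsonRate m M) := by
  have hm := hA.m_pos
  have hM := hA.M_pos
  have rate_pos := richardsonRate_pos m M
  have recurrence (j : ℕ) : ‖W - sparseRichardson A M Λ S U (j + 1)‖ ≤
      richardsonRate m M * ‖W - sparseRichardson A M Λ S U j‖ +
        (‖U - trunc (S 0) U‖ + M⁻¹ * γ * ((2 + M / m) * ‖U‖)) := by
    calc _ ≤ √(1 - m / M) * ‖W - sparseRichardson A M Λ S U j‖ + ‖U - trunc (S 0) U‖ +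
          M⁻¹ * γ * ((2 + M / m) * ‖U‖ + ‖W - sparseRichardson A M Λ S U j‖) := by
          refine (hW.norm_sub_sparseRichardson_succ_le hA hS j).trans ?_
          rw [← mul_assoc]
          gcongr
          exact hW.norm_trunc_sub_le hA _ _
      _ = (√(1 - m / M) + M⁻¹ * γ) * ‖W - sparseRichardson A M Λ S U j‖ +
          (‖U - trunc (S 0) U‖ + M⁻¹ * γ * ((2 + M / m) * ‖U‖)) := by ring
      _ ≤ _ := by
          have := (inv_mul_le_iff₀ hM).2 hγ'
          gcongr
          rw [richardsonRate] at this ⊢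
          linarith
  refine (le_geometric_of_affine_recurrence (x := fun j => ‖W - sparseRichardson A M Λ S U j‖)
    rate_pos.le hA.richardsonRate_lt_one (by positivity) recurrence n).trans ?_
  gcongr
  rw [sparseRichardson, sub_zero]
  exact hW.norm_le hA

theorem IsGalerkinSeq.norm_residual_sub_trunc_le (hW : IsGalerkinSeq A Λ U W)
    (hA : IsElliptic A m M) (hS : IsApproxBanded A S γ) (hγ : 0 ≤ γ) (hγ' : γ ≤ M) (n : ℕ) :
    ‖A (U - W) - trunc (S (n + 1)) (A (U - W))‖ ≤
      M * ‖U - trunc (S 0) U‖ + 2 * M * ‖W - sparseRichardson A M Λ S U n‖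
        + γ * ((2 + M / m) * ‖U‖) := by
  set x := sparseRichardson A M Λ S U n
  set r := A (trunc (S 0) U - x) with hr
  have residual_sub : A (U - W) - trunc (S (n + 1)) r =
      A (U - trunc (S 0) U) - A (W - x) + (r - trunc (S (n + 1)) r) := by
    rw [← map_sub, ← add_sub_assoc, hr, ← map_add]
    congr 2
    abel
  calc ‖A (U - W) - trunc (S (n + 1)) (A (U - W))‖
      ≤ ‖A (U - W) - trunc (S (n + 1)) r‖ := norm_sub_trunc_le_norm_sub _ _ (trunc_trunc _ _)
    _ ≤ ‖A (U - trunc (S 0) U)‖ + ‖A (W - x)‖ + ‖r - trunc (S (n + 1)) r‖ := by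
        rw [residual_sub]
        exact (norm_add_le _ _).trans (by gcongr; exact _root_.norm_sub_le _ _)
    _ ≤ M * ‖U - trunc (S 0) U‖ + M * ‖W - x‖ + γ * ((2 + M / m) * ‖U‖ + ‖W - x‖) := by
        gcongr
        · exact hA.norm_apply_le _
        · exact hA.norm_apply_le _
        · refine (hS.norm_sub_trunc_le n _ (hS.trunc_sub_sparseRichardson n)).trans ?_
          gcongr
          exact hW.norm_trunc_sub_le hA _ _
    _ ≤ _ := by
        have : γ * ‖W - x‖ ≤ M * ‖W - x‖ := by gcongr
        linarith

theorem IsElliptic.exists_norm_residual_sub_trunc_le (hA : IsElliptic A m M) :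
    ∃ C > 0, ∀ {Λ : Finset ι} {U W : ℓ²(ι, 𝕜)}, IsGalerkinSeq A Λ U W →
      ∀ {S : ℕ → Finset ι} {γ : ℝ}, 0 ≤ γ → γ ≤ M * (1 - richardsonRate m M) →
      IsApproxBanded A S γ → ∀ n, ‖A (U - W) - trunc (S (n + 1)) (A (U - W))‖ ≤
        C * (‖U - trunc (S 0) U‖ + richardsonRate m M ^ n * ‖U‖ + γ * ‖U‖) := by
  have hm := hA.m_pos
  have hM := hA.M_pos
  have rate_pos := richardsonRate_pos m M
  have gap_pos : 0 < 1 - richardsonRate m M := sub_pos.2 hA.richardsonRate_lt_one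
  set q := richardsonRate m M
  set c₁ := M + 2 * M / (1 - q)
  set c₂ := 2 * M * (1 + M / m)
  set c₃ := 2 * (2 + M / m) / (1 - q) + (2 + M / m)
  have c₁_pos : 0 < c₁ := by positivity
  have c₂_pos : 0 < c₂ := by positivity
  have c₃_pos : 0 < c₃ := by positivity
  refine ⟨c₁ + c₂ + c₃, by positivity, fun {Λ U W} hW {S γ} hγ hγ' hS n => ?_⟩
  calc ‖A (U - W) - trunc (S (n + 1)) (A (U - W))‖
      ≤ M * ‖U - trunc (S 0) U‖ + 2 * M * ‖W - sparseRichardson A M Λ S U n‖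
        + γ * ((2 + M / m) * ‖U‖) :=
        hW.norm_residual_sub_trunc_le hA hS hγ
          (hγ'.trans (mul_le_of_le_one_right hM.le (by linarith))) n
    _ ≤ M * ‖U - trunc (S 0) U‖ + 2 * M * (q ^ n * ((1 + M / m) * ‖U‖) +
          (‖U - trunc (S 0) U‖ + M⁻¹ * γ * ((2 + M / m) * ‖U‖)) / (1 - q))
        + γ * ((2 + M / m) * ‖U‖) := by
        gcongr
        exact hW.norm_sub_sparseRichardson_le hA hS hγ hγ' n
    _ = c₁ * ‖U - trunc (S 0) U‖ + c₂ * (q ^ n * ‖U‖) + c₃ * (γ * ‖U‖) := by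
        simp only [c₁, c₂, c₃]
        field_simp
        ring
    _ ≤ (c₁ + c₂ + c₃) * ‖U - trunc (S 0) U‖ + (c₁ + c₂ + c₃) * (q ^ n * ‖U‖) +
          (c₁ + c₂ + c₃) * (γ * ‖U‖) := by
        gcongr <;> linarith
    _ = _ := by ring

end Residual

section SchurTest

variable {ι κ 𝕜 : Type*} [RCLike 𝕜]

theorem norm_le_of_sum_mul_le {w : ι → κ → ℝ} {Z : ℝ} (hZ : 0 ≤ Z) (hw : ∀ l k, 0 ≤ w l k)
    (hrow : ∀ l (T : Finset κ), ∑ k ∈ T, w l k ≤ Z)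
    (hcol : ∀ k (T : Finset ι), ∑ l ∈ T, w l k ≤ Z)
    {y : ℓ²(ι, 𝕜)} {v : ℓ²(κ, 𝕜)} {S : Finset κ}
    (hy : ∀ l, ‖y l‖ ≤ ∑ k ∈ S, w l k * ‖v k‖) : ‖y‖ ≤ Z * ‖v‖ := by
  classical
  have cauchy_schwarz (l : ι) : ‖y l‖ ^ 2 ≤ Z * ∑ k ∈ S, w l k * ‖v k‖ ^ 2 := by
    have weighted_sq_nonneg (k : κ) : 0 ≤ w l k * ‖v k‖ ^ 2 := mul_nonneg (hw l k) (sq_nonneg _)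
    calc ‖y l‖ ^ 2 ≤ (∑ k ∈ S, w l k * ‖v k‖) ^ 2 := by gcongr; exact hy l
      _ ≤ (∑ k ∈ S, w l k) * ∑ k ∈ S, w l k * ‖v k‖ ^ 2 :=
        Finset.sum_sq_le_sum_mul_sum_of_sq_le_mul S (fun k _ => hw l k)
          (fun k _ => weighted_sq_nonneg k) fun k _ => (by ring : _ = _).le
      _ ≤ Z * ∑ k ∈ S, w l k * ‖v k‖ ^ 2 :=
        mul_le_mul_of_nonneg_right (hrow l S) (Finset.sum_nonneg fun k _ => weighted_sq_nonneg k)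
  refine lp.norm_le_of_forall_sum_le (p := 2) (by norm_num) (by positivity) fun T => ?_
  simp only [ENNReal.toReal_ofNat, Real.rpow_ofNat]
  calc ∑ l ∈ T, ‖y l‖ ^ 2 ≤ ∑ l ∈ T, Z * ∑ k ∈ S, w l k * ‖v k‖ ^ 2 :=
        Finset.sum_le_sum fun l _ => cauchy_schwarz l
    _ = Z * ∑ k ∈ S, (∑ l ∈ T, w l k) * ‖v k‖ ^ 2 := by
        simp only [← Finset.mul_sum, Finset.sum_comm (s := T), ← Finset.sum_mul]
    _ ≤ Z * ∑ k ∈ S, Z * ‖v k‖ ^ 2 := by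
        gcongr with k
        exact hcol k T
    _ = Z ^ 2 * ‖trunc S v‖ ^ 2 := by rw [norm_sq_trunc, ← Finset.mul_sum]; ring
    _ ≤ Z ^ 2 * ‖v‖ ^ 2 := by gcongr; exact norm_trunc_le S v
    _ = (Z * ‖v‖) ^ 2 := (mul_pow _ _ _).symm

theorem apply_eq_sum_of_trunc_eq_self [DecidableEq κ] (A : ℓ²(κ, 𝕜) →L[𝕜] ℓ²(ι, 𝕜)) {S : Finset κ}
    {v : ℓ²(κ, 𝕜)} (hv : trunc S v = v) (l : ι) : A v l = ∑ k ∈ S, A (lp.single 2 k 1) l * v k := by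
  have single_eq (k : κ) : lp.single (E := fun _ : κ => 𝕜) 2 k (v k) = v k • lp.single 2 k 1 := by
    rw [← lp.single_smul, smul_eq_mul, mul_one]
  conv_lhs => rw [← hv, trunc_eq_sum_single]
  simp only [single_eq, map_sum, map_smul, lp.coeFn_sum, Finset.sum_apply, lp.coeFn_smul,
    Pi.smul_apply, smul_eq_mul, mul_comm]

end SchurTest

section Lattice

variable {d : ℕ}

theorem latticeDist_eq_dist (k l : Fin d → ℤ) :
    latticeDist k l = dist (WithLp.toLp 2 fun i => (k i : ℝ) : EuclideanSpace ℝ (Fin d))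
      (WithLp.toLp 2 fun i => (l i : ℝ)) := by
  rw [latticeDist, dist_eq_norm]
  congr 1
  ext i
  exact Int.cast_sub _ _

theorem latticeDist_self (k : Fin d → ℤ) : latticeDist k k = 0 := by
  rw [latticeDist_eq_dist, dist_self]

theorem latticeDist_comm (k l : Fin d → ℤ) : latticeDist k l = latticeDist l k := by
  rw [latticeDist_eq_dist, latticeDist_eq_dist, dist_comm]

theorem latticeDist_triangle (j k l : Fin d → ℤ) :
    latticeDist j l ≤ latticeDist j k + latticeDist k l := by
  simp only [latticeDist_eq_dist]
  exact dist_triangle _ _ _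

theorem abs_sub_le_latticeDist (k l : Fin d → ℤ) (i : Fin d) :
    |((k i - l i : ℤ) : ℝ)| ≤ latticeDist k l :=
  PiLp.norm_apply_le (WithLp.toLp 2 fun i => ((k i - l i : ℤ) : ℝ) : EuclideanSpace ℝ (Fin d)) i

variable {K : Set (Fin d → ℤ)}

open scoped Classical in
/-- The set of indices at distance at most `ρ` from `S`, see `mem_enlarge`. It is constructed from
finite cubes of lattice points in order to be a `Finset`. -/
def enlarge (S : Finset K) (ρ : ℝ) : Finset K :=
  S.biUnion fun l => ((Finset.Icc (l.1 - fun _ => (⌊ρ⌋₊ : ℤ)) (l.1 + fun _ => (⌊ρ⌋₊ : ℤ))).subtype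
    (· ∈ K)).filter fun k => latticeDist k.1 l.1 ≤ ρ

theorem mem_enlarge {S : Finset K} {ρ : ℝ} {k : K} :
    k ∈ enlarge S ρ ↔ ∃ l ∈ S, latticeDist k.1 l.1 ≤ ρ := by
  simp only [enlarge, Finset.mem_biUnion, Finset.mem_filter, Finset.mem_subtype, Finset.mem_Icc,
    Pi.le_def, Pi.sub_apply, Pi.add_apply]
  refine exists_congr fun l => and_congr_right fun _ => and_iff_right_of_imp fun hkl => ?_
  have natAbs_sub_le (i : Fin d) : (k.1 i - l.1 i).natAbs ≤ ⌊ρ⌋₊ := by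
    refine Nat.le_floor (le_trans ?_ ((abs_sub_le_latticeDist k.1 l.1 i).trans hkl))
    rw [Nat.cast_natAbs, Int.cast_abs]
  constructor <;> intro i <;> have := natAbs_sub_le i <;> omega

theorem subset_enlarge (S : Finset K) {ρ : ℝ} (hρ : 0 ≤ ρ) : S ⊆ enlarge S ρ :=
  fun k hk => mem_enlarge.2 ⟨k, hk, by rwa [latticeDist_self]⟩

theorem enlarge_mono (S : Finset K) {ρ ρ' : ℝ} (h : ρ ≤ ρ') : enlarge S ρ ⊆ enlarge S ρ' := by
  intro k hk
  obtain ⟨l, hl, hkl⟩ := mem_enlarge.1 hk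
  exact mem_enlarge.2 ⟨l, hl, hkl.trans h⟩

theorem enlarge_enlarge_subset (S : Finset K) (ρ ρ' : ℝ) :
    enlarge (enlarge S ρ) ρ' ⊆ enlarge S (ρ + ρ') := by
  intro j hj
  obtain ⟨k, hk, hjk⟩ := mem_enlarge.1 hj
  obtain ⟨l, hl, hkl⟩ := mem_enlarge.1 hk
  exact mem_enlarge.2 ⟨l, hl, (latticeDist_triangle j.1 k.1 l.1).trans (by linarith)⟩

theorem card_enlarge_le (S : Finset K) {ρ : ℝ} (hρ : 0 ≤ ρ) :
    ((enlarge S ρ).card : ℝ) ≤ S.card * (2 * ρ + 1) ^ d := by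
  classical
  have card_cube (l : Fin d → ℤ) :
      (Finset.Icc (l - fun _ => (⌊ρ⌋₊ : ℤ)) (l + fun _ => (⌊ρ⌋₊ : ℤ))).card =
        (2 * ⌊ρ⌋₊ + 1) ^ d := by
    have card_side (i : Fin d) : (l i + ⌊ρ⌋₊ + 1 - (l i - ⌊ρ⌋₊)).toNat = 2 * ⌊ρ⌋₊ + 1 := by omega
    simp only [Pi.card_Icc, Pi.sub_apply, Pi.add_apply, Int.card_Icc, card_side,
      Finset.prod_const, Finset.card_univ, Fintype.card_fin]
  have card_le : (enlarge S ρ).card ≤ S.card * (2 * ⌊ρ⌋₊ + 1) ^ d := by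
    refine Finset.card_biUnion_le_card_mul _ _ _ fun l _ => (Finset.card_filter_le _ _).trans ?_
    rw [Finset.card_subtype, ← card_cube l]
    exact Finset.card_filter_le _ _
  calc ((enlarge S ρ).card : ℝ) ≤ S.card * (2 * ⌊ρ⌋₊ + 1) ^ d := by exact_mod_cast card_le
    _ ≤ S.card * (2 * ρ + 1) ^ d := by gcongr; exact Nat.floor_le hρ

theorem summable_exp_neg_mul_abs_int {b : ℝ} (hb : 0 < b) :
    Summable fun j : ℤ => Real.exp (-b * |(j : ℝ)|) := by
  have summable_nat : Summable fun n : ℕ => Real.exp (-b * n) := by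
    simpa only [mul_comm] using Real.summable_exp_nat_mul_iff.2 (neg_lt_zero.2 hb)
  refine Summable.of_nat_of_neg ?_ ?_
  · simpa only [Int.cast_natCast, Nat.abs_cast] using summable_nat
  · simpa only [Int.cast_neg, Int.cast_natCast, abs_neg, Nat.abs_cast] using summable_nat

theorem exp_neg_latticeDist_le_prod {a : ℝ} (ha : 0 ≤ a) (k l : Fin d → ℤ) :
    Real.exp (-a * latticeDist k l) ≤
      ∏ i, Real.exp (-(a / (d + 1)) * |((k i - l i : ℤ) : ℝ)|) := by
  have sum_le : ∑ i, |((k i - l i : ℤ) : ℝ)| ≤ (d + 1) * latticeDist k l := by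
    calc ∑ i, |((k i - l i : ℤ) : ℝ)| ≤ ∑ _i : Fin d, latticeDist k l :=
          Finset.sum_le_sum fun i _ => abs_sub_le_latticeDist k l i
      _ = d * latticeDist k l := by simp
      _ ≤ (d + 1) * latticeDist k l := by
          gcongr
          exacts [norm_nonneg _, le_add_of_nonneg_right zero_le_one]
  rw [← Real.exp_sum, ← Finset.mul_sum, Real.exp_le_exp, neg_mul, neg_mul, neg_le_neg_iff]
  calc a / (d + 1) * ∑ i, |((k i - l i : ℤ) : ℝ)| ≤ a / (d + 1) * ((d + 1) * latticeDist k l) := by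
        gcongr
    _ = a * latticeDist k l := by field_simp

theorem exists_sum_exp_neg_latticeDist_le (d : ℕ) {a : ℝ} (ha : 0 < a) :
    ∃ Z > 0, ∀ (l : Fin d → ℤ) (T : Finset (Fin d → ℤ)),
      ∑ k ∈ T, Real.exp (-a * latticeDist k l) ≤ Z := by
  have summable := summable_exp_neg_mul_abs_int (b := a / (d + 1)) (by positivity)
  set f : ℤ → ℝ := fun j => Real.exp (-(a / (d + 1)) * |(j : ℝ)|)
  have f_nonneg (j : ℤ) : 0 ≤ f j := (Real.exp_pos _).le
  have tsum_pos : 0 < ∑' j, f j := summable.tsum_pos f_nonneg 0 (Real.exp_pos _)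
  refine ⟨(∑' j, f j) ^ d, by positivity, fun l T => ?_⟩
  have subset_product : T ⊆ Fintype.piFinset fun i => T.image fun k => k i :=
    fun k hk => Fintype.mem_piFinset.2 fun i => Finset.mem_image_of_mem _ hk
  calc ∑ k ∈ T, Real.exp (-a * latticeDist k l)
      ≤ ∑ k ∈ T, ∏ i, f (k i - l i) :=
        Finset.sum_le_sum fun k _ => exp_neg_latticeDist_le_prod ha.le k l
    _ ≤ ∑ k ∈ Fintype.piFinset fun i => T.image fun k => k i, ∏ i, f (k i - l i) :=
        Finset.sum_le_sum_of_subset_of_nonneg subset_product fun _ _ _ =>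
          Finset.prod_nonneg fun _ _ => f_nonneg _
    _ = ∏ i, ∑ j ∈ T.image fun k => k i, f (j - l i) :=
        (Finset.prod_univ_sum (fun i => T.image fun k => k i) fun i j => f (j - l i)).symm
    _ ≤ ∏ _i : Fin d, ∑' j, f j := by
        refine Finset.prod_le_prod
          (fun _ _ => Finset.sum_nonneg fun _ _ => f_nonneg _) fun i _ => ?_
        rw [← Finset.sum_image (g := fun j => j - l i) (f := f) sub_left_injective.injOn]
        exact summable.sum_le_tsum _ fun j _ => f_nonneg j
    _ = (∑' j, f j) ^ d := by simp

variable {𝕜 : Type} [RCLike 𝕜] {A : ℓ²(K, 𝕜) →L[𝕜] ℓ²(K, 𝕜)} {c a : ℝ}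

theorem norm_apply_sub_trunc_apply_le_sum {S T : Finset K} {J : ℝ} {v : ℓ²(K, 𝕜)} (ha : 0 ≤ a)
    (hA : ExpDecay c a fun l k => A (lp.single 2 k 1) l) (hT : enlarge S J ⊆ T)
    (hv : trunc S v = v) (l : K) :
    ‖(A v - trunc T (A v)) l‖ ≤ ∑ k ∈ S,
      |c| * Real.exp (-(a / 2) * J) * Real.exp (-(a / 2) * latticeDist l.1 k.1) * ‖v k‖ := by
  rw [lp.coeFn_sub, Pi.sub_apply, trunc_apply]
  split_ifs with hl
  · rw [sub_self, norm_zero]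
    positivity
  rw [sub_zero, apply_eq_sum_of_trunc_eq_self A hv]
  refine (norm_sum_le _ _).trans (Finset.sum_le_sum fun k hk => ?_)
  rw [norm_mul]
  gcongr
  have J_lt : J < latticeDist l.1 k.1 := by
    by_contra! hle
    exact hl (hT (mem_enlarge.2 ⟨k, hk, hle⟩))
  calc ‖A (lp.single 2 k 1) l‖ ≤ c * Real.exp (-a * latticeDist l.1 k.1) := hA l k
    _ ≤ |c| * Real.exp (-(a / 2) * J + -(a / 2) * latticeDist l.1 k.1) := by
        have : a / 2 * J ≤ a / 2 * latticeDist l.1 k.1 := by gcongr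
        gcongr
        · exact le_abs_self c
        · linarith
    _ = |c| * Real.exp (-(a / 2) * J) * Real.exp (-(a / 2) * latticeDist l.1 k.1) := by
        rw [Real.exp_add, mul_assoc]

theorem exists_norm_sub_trunc_apply_le (ha : 0 < a)
    (hA : ExpDecay c a fun l k => A (lp.single 2 k 1) l) :
    ∃ C > 0, ∀ (J : ℝ) (S T : Finset K), enlarge S J ⊆ T → ∀ v, trunc S v = v →
      ‖A v - trunc T (A v)‖ ≤ C * Real.exp (-(a / 2) * J) * ‖v‖ := by
  obtain ⟨Z, Z_pos, sum_le⟩ := exists_sum_exp_neg_latticeDist_le d (half_pos ha)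
  have sum_le_of_subtype (l : K) (T : Finset K) :
      ∑ k ∈ T, Real.exp (-(a / 2) * latticeDist k.1 l.1) ≤ Z := by
    rw [← Finset.sum_image (g := Subtype.val)
      (f := fun k => Real.exp (-(a / 2) * latticeDist k l.1)) Subtype.val_injective.injOn]
    exact sum_le l.1 _
  refine ⟨(|c| + 1) * Z, by positivity, fun J S T hT v hv => ?_⟩
  set e := Real.exp (-(a / 2) * J)
  have sum_weight_le (l : K) (T : Finset K) :
      ∑ k ∈ T, |c| * e * Real.exp (-(a / 2) * latticeDist k.1 l.1) ≤ |c| * e * Z := by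
    rw [← Finset.mul_sum]
    gcongr
    exact sum_le_of_subtype l T
  calc ‖A v - trunc T (A v)‖ ≤ |c| * e * Z * ‖v‖ :=
        norm_le_of_sum_mul_le (by positivity) (fun _ _ => by positivity)
          (by simpa only [latticeDist_comm] using sum_weight_le) sum_weight_le
          (norm_apply_sub_trunc_apply_le_sum ha.le hA hT hv)
    _ ≤ (|c| + 1) * e * Z * ‖v‖ := by gcongr; exact le_add_of_nonneg_right zero_le_one
    _ = (|c| + 1) * Z * e * ‖v‖ := by ring

theorem exists_isApproxBanded_enlarge (ha : 0 < a)
    (hA : ExpDecay c a fun l k => A (lp.single 2 k 1) l) :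
    ∃ C > 0, ∀ (S : Finset K) (J : ℝ), 0 ≤ J →
      IsApproxBanded A (fun j => enlarge S (j * J)) (C * Real.exp (-(a / 2) * J)) := by
  obtain ⟨C, C_pos, norm_le⟩ := exists_norm_sub_trunc_apply_le ha hA
  refine ⟨C, C_pos, fun S J hJ => ⟨fun i j hij => enlarge_mono S (by gcongr), fun j v hv => ?_⟩⟩
  refine norm_le J _ _ ?_ v hv
  have enlarge_step := enlarge_enlarge_subset S (j * J) J
  rwa [Nat.cast_succ, add_one_mul]

end Lattice

section SparseResidual

theorem exists_nat_exp_neg_mul_le {b c : ℝ} (hb : 0 < b) (hc : 0 < c) :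
    ∃ C > 0, ∀ δ : ℝ, 0 < δ → δ < 1 →
      ∃ n : ℕ, Real.exp (-b * n) ≤ c * δ ∧ (n : ℝ) ≤ C * (1 - Real.log δ) := by
  refine ⟨(|Real.log c| + 1) / b + 1, by positivity, fun δ hδ hδ1 => ?_⟩
  have log_neg : Real.log δ < 0 := Real.log_neg hδ hδ1
  set x := (|Real.log c| + 1) / b * (1 - Real.log δ) with hx
  have x_nonneg : 0 ≤ x := mul_nonneg (by positivity) (by linarith)
  refine ⟨⌈x⌉₊, ?_, by linarith [Nat.ceil_lt_add_one x_nonneg]⟩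
  rw [← Real.le_log_iff_exp_le (by positivity), Real.log_mul hc.ne' hδ.ne']
  have exponent_le : (|Real.log c| + 1) * (1 - Real.log δ) ≤ b * ⌈x⌉₊ := by
    calc (|Real.log c| + 1) * (1 - Real.log δ) = b * x := by rw [hx]; field_simp
      _ ≤ b * ⌈x⌉₊ := by gcongr; exact Nat.le_ceil x
  have : |Real.log c| * Real.log δ ≤ 0 := mul_nonpos_of_nonneg_of_nonpos (abs_nonneg _) log_neg.le
  linarith [neg_abs_le (Real.log c)]

theorem exists_nat_pow_le {q c : ℝ} (hq : 0 < q) (hq1 : q < 1) (hc : 0 < c) :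
    ∃ C > 0, ∀ δ : ℝ, 0 < δ → δ < 1 →
      ∃ n : ℕ, q ^ n ≤ c * δ ∧ (n : ℝ) ≤ C * (1 - Real.log δ) := by
  have exp_eq (n : ℕ) : Real.exp (-(-Real.log q) * n) = q ^ n := by
    rw [neg_neg, mul_comm, Real.exp_nat_mul, Real.exp_log hq]
  simpa only [exp_eq] using exists_nat_exp_neg_mul_le (neg_pos.2 (Real.log_neg hq hq1)) hc

variable {d : ℕ} {K : Set (Fin d → ℤ)} {𝕜 : Type} [RCLike 𝕜] {A : ℓ²(K, 𝕜) →L[𝕜] ℓ²(K, 𝕜)}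
  {m M : ℝ}

theorem exists_isApproxBanded_mul {cA a c : ℝ} (ha : 0 < a)
    (hdecay : ExpDecay cA a fun l k => A (lp.single 2 k 1) l) (hc : 0 < c) :
    ∃ C > 0, ∀ δ : ℝ, 0 < δ → δ < 1 → ∃ J : ℕ, (J : ℝ) ≤ C * (1 - Real.log δ) ∧
      ∀ S : Finset K, IsApproxBanded A (fun j => enlarge S (j * J)) (c * δ) := by
  obtain ⟨C, C_pos, banded⟩ := exists_isApproxBanded_enlarge ha hdecay
  obtain ⟨CJ, CJ_pos, exists_radius⟩ := exists_nat_exp_neg_mul_le (half_pos ha) (div_pos hc C_pos)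
  refine ⟨CJ, CJ_pos, fun δ hδ hδ1 => ?_⟩
  obtain ⟨J, exp_J_le, J_le⟩ := exists_radius δ hδ hδ1
  have error_le : C * Real.exp (-(a / 2) * J) ≤ c * δ :=
    calc C * Real.exp (-(a / 2) * J) ≤ C * (c / C * δ) := by gcongr
      _ = c * δ := by field_simp
  refine ⟨J, J_le, fun S => ⟨(banded S J J.cast_nonneg).mono, fun j v hv => ?_⟩⟩
  exact ((banded S J J.cast_nonneg).norm_sub_trunc_le j v hv).trans (by gcongr)

theorem IsElliptic.exists_card_residual_le (hA : IsElliptic A m M) {cA a : ℝ} (ha : 0 < a)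
    (hdecay : ExpDecay cA a fun l k => A (lp.single 2 k 1) l) :
    ∃ c > 0, ∃ C > 0, ∀ {Λ : Finset K} {U W : ℓ²(K, 𝕜)}, IsGalerkinSeq A Λ U W →
      ∀ {δ : ℝ}, 0 < δ → δ < 1 → ∀ {S₀ : Finset K}, ‖U - trunc S₀ U‖ ≤ c * δ * ‖U‖ →
      ∃ S : Finset K, ‖A (U - W) - trunc S (A (U - W))‖ ≤ δ * ‖A U‖ ∧
        (S.card : ℝ) ≤ S₀.card * (C * (1 - Real.log δ) ^ 2) ^ d := by
  have hm := hA.m_pos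
  obtain ⟨C₁, C₁_pos, residual_le⟩ := hA.exists_norm_residual_sub_trunc_le
  set q := richardsonRate m M
  have gap_pos : 0 < M * (1 - q) := mul_pos hA.M_pos (sub_pos.2 hA.richardsonRate_lt_one)
  set c := m / (3 * C₁) with hc
  have c_pos : 0 < c := by positivity
  have band_tol_pos : 0 < min c (M * (1 - q)) := lt_min c_pos gap_pos
  obtain ⟨Cn, Cn_pos, exists_steps⟩ := exists_nat_pow_le (richardsonRate_pos m M)
    hA.richardsonRate_lt_one c_pos
  obtain ⟨CJ, CJ_pos, exists_radius⟩ := exists_isApproxBanded_mul ha hdecay band_tol_pos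
  refine ⟨c, c_pos, 2 * (Cn + 1) * CJ + 1, by positivity, fun {Λ U W} hW {δ} hδ hδ1 {S₀} hS₀ => ?_⟩
  obtain ⟨n, pow_n_le, n_le⟩ := exists_steps δ hδ hδ1
  obtain ⟨J, J_le, banded⟩ := exists_radius δ hδ hδ1
  have log_neg : Real.log δ < 0 := Real.log_neg hδ hδ1
  have band_tol_le : min c (M * (1 - q)) * δ ≤ M * (1 - q) :=
    (mul_le_of_le_one_right band_tol_pos.le hδ1.le).trans (min_le_right _ _)
  refine ⟨enlarge S₀ ((n + 1 : ℕ) * J), ?accuracy, ?cardinality⟩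
  case accuracy =>
    have start_le : ‖U - trunc (enlarge S₀ ((0 : ℕ) * J)) U‖ ≤ c * δ * ‖U‖ :=
      (norm_sub_trunc_le_norm_sub _ _
        (trunc_trunc_of_subset (subset_enlarge S₀ (by simp)) U)).trans hS₀
    calc _ ≤ C₁ * (‖U - trunc (enlarge S₀ ((0 : ℕ) * J)) U‖ + q ^ n * ‖U‖ +
            min c (M * (1 - q)) * δ * ‖U‖) :=
          residual_le hW (by positivity) band_tol_le (banded S₀) n
      _ ≤ C₁ * (c * δ * ‖U‖ + c * δ * ‖U‖ + c * δ * ‖U‖) := by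
          gcongr
          exact min_le_left _ _
      _ = δ * (m * ‖U‖) := by rw [hc]; field_simp; ring
      _ ≤ δ * ‖A U‖ := by gcongr; exact hA.mul_norm_le_norm_apply U
  case cardinality =>
    refine (card_enlarge_le S₀ (by positivity)).trans ?_
    have steps_le : ((n + 1 : ℕ) : ℝ) ≤ (Cn + 1) * (1 - Real.log δ) := by
      rw [Nat.cast_succ]
      linarith
    have one_le_sq : 1 ≤ (1 - Real.log δ) ^ 2 := one_le_pow₀ (by linarith)
    gcongr
    calc 2 * (((n + 1 : ℕ) : ℝ) * J) + 1
        ≤ 2 * ((Cn + 1) * (1 - Real.log δ) * (CJ * (1 - Real.log δ))) + (1 - Real.log δ) ^ 2 := by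
          have : 0 ≤ 1 - Real.log δ := by linarith
          gcongr
      _ = (2 * (Cn + 1) * CJ + 1) * (1 - Real.log δ) ^ 2 := by ring

/-- Sparsity of Gevrey type: `U` has norm at most `G` and its best `N`-term approximations converge
like `exp (-η N ^ s)`. The factor `2` allows for an infimum over sets that is not attained. -/
structure IsExpSparse (η s G : ℝ) (U : ℓ²(K, 𝕜)) : Prop where
  norm_le : ‖U‖ ≤ G
  exists_trunc : ∀ N : ℕ, ∃ S : Finset K, S.card ≤ N ∧
    ‖U - trunc S U‖ ≤ 2 * (G * Real.exp (-(η * (N : ℝ) ^ s)))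

variable {η s G C CS C₀ ε L : ℝ} {U : ℓ²(K, 𝕜)}

theorem IsExpSparse.exists_card_le (h : IsExpSparse η s G U) (hη : 0 < η) (hs : 0 < s)
    (hL : 1 ≤ L) : ∃ S : Finset K, (S.card : ℝ) ≤ ((2 / η) ^ s⁻¹ + 1) * L ^ s⁻¹ ∧
      ‖U - trunc S U‖ ≤ 2 * (G * Real.exp (-(2 * L))) := by
  have x_nonneg : 0 ≤ 2 / η * L := by positivity
  have G_nonneg : 0 ≤ G := (norm_nonneg U).trans h.norm_le
  have exponent_le : 2 * L ≤ η * (⌈(2 / η * L) ^ s⁻¹⌉₊ : ℝ) ^ s :=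
    calc 2 * L = η * (2 / η * L) := by field_simp
      _ = η * ((2 / η * L) ^ s⁻¹) ^ s := by rw [Real.rpow_inv_rpow x_nonneg hs.ne']
      _ ≤ η * (⌈(2 / η * L) ^ s⁻¹⌉₊ : ℝ) ^ s := by gcongr; exact Nat.le_ceil _
  obtain ⟨S, card_le, norm_sub_le⟩ := h.exists_trunc ⌈(2 / η * L) ^ s⁻¹⌉₊
  refine ⟨S, ?_, norm_sub_le.trans (by gcongr)⟩
  calc (S.card : ℝ) ≤ (⌈(2 / η * L) ^ s⁻¹⌉₊ : ℝ) := by exact_mod_cast card_le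
    _ ≤ (2 / η * L) ^ s⁻¹ + 1 := (Nat.ceil_lt_add_one (by positivity)).le
    _ ≤ (2 / η) ^ s⁻¹ * L ^ s⁻¹ + L ^ s⁻¹ := by
        rw [Real.mul_rpow (by positivity) (by positivity)]
        gcongr
        exact Real.one_le_rpow hL (by positivity)
    _ = ((2 / η) ^ s⁻¹ + 1) * L ^ s⁻¹ := by ring

/-- The logarithm in powers of which the complexity of the algorithm is measured; `G` is the
sparsity norm of the solution `U`, and `ε` the relative tolerance for the residual. -/
def logComplexity (A : ℓ²(K, 𝕜) →L[𝕜] ℓ²(K, 𝕜)) (U : ℓ²(K, 𝕜)) (C G ε : ℝ) : ℝ :=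
  Real.log (C * (G / ‖A U‖) / ε)

theorem IsElliptic.norm_apply_pos (hA : IsElliptic A m M) (hU : U ≠ 0) : 0 < ‖A U‖ :=
  (mul_pos hA.m_pos (norm_pos_iff.2 hU)).trans_le (hA.mul_norm_le_norm_apply U)

theorem IsElliptic.exp_one_le_mul_div (hA : IsElliptic A m M) (hU : U ≠ 0) (hG : ‖U‖ ≤ G)
    (hCS : Real.exp 1 * M ≤ CS) : Real.exp 1 ≤ CS * (G / ‖A U‖) := by
  have hM := hA.M_pos
  have hAU := hA.norm_apply_pos hU
  have G_nonneg : 0 ≤ G := (norm_nonneg U).trans hG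
  rw [← mul_div_assoc, le_div_iff₀ hAU]
  calc Real.exp 1 * ‖A U‖ ≤ Real.exp 1 * (M * G) := by
        gcongr
        exact (hA.norm_apply_le U).trans (by gcongr)
    _ = Real.exp 1 * M * G := by ring
    _ ≤ CS * G := by gcongr

theorem IsElliptic.one_sub_log_le_logComplexity (hA : IsElliptic A m M) (hU : U ≠ 0)
    (hG : ‖U‖ ≤ G) (hCS : Real.exp 1 * M ≤ CS) (hε : 0 < ε) :
    1 - Real.log ε ≤ logComplexity A U CS G ε := by
  have exp_one_le := hA.exp_one_le_mul_div hU hG hCS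
  have ratio_pos : 0 < CS * (G / ‖A U‖) := (Real.exp_pos 1).trans_le exp_one_le
  rw [logComplexity, Real.log_div ratio_pos.ne' hε.ne']
  exact sub_le_sub_right ((Real.le_log_iff_exp_le ratio_pos).2 exp_one_le) _

theorem IsElliptic.mul_exp_neg_logComplexity_le (hA : IsElliptic A m M) (hU : U ≠ 0)
    (hG : ‖U‖ ≤ G) (hCS : Real.exp 1 * M ≤ CS) (hC : 0 < C) (hCS' : 2 * M / C ≤ CS) (hε : 0 < ε) :
    2 * (G * Real.exp (-(2 * logComplexity A U CS G ε))) ≤ C * ε ^ 2 * ‖U‖ := by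
  have hM := hA.M_pos
  have hAU := hA.norm_apply_pos hU
  have G_pos : 0 < G := (norm_pos_iff.2 hU).trans_le hG
  have CS_pos : 0 < CS := (mul_pos (Real.exp_pos 1) hM).trans_le hCS
  have ratio_ge_one : 1 ≤ CS * (G / ‖A U‖) :=
    (Real.one_le_exp zero_le_one).trans (hA.exp_one_le_mul_div hU hG hCS)
  have exp_eq : Real.exp (-(2 * logComplexity A U CS G ε)) = (ε / (CS * (G / ‖A U‖))) ^ 2 := by
    rw [logComplexity, Real.exp_neg, mul_comm, Real.exp_mul, Real.exp_log (by positivity),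
      Real.rpow_two, ← inv_pow, inv_div]
  calc 2 * (G * Real.exp (-(2 * logComplexity A U CS G ε)))
      = 2 / CS * (ε ^ 2 * ‖A U‖) / (CS * (G / ‖A U‖)) := by rw [exp_eq]; field_simp
    _ ≤ 2 / CS * (ε ^ 2 * ‖A U‖) := div_le_self (by positivity) ratio_ge_one
    _ ≤ 2 / CS * (ε ^ 2 * (M * ‖U‖)) := by gcongr; exact hA.norm_apply_le U
    _ = 2 * M / CS * (ε ^ 2 * ‖U‖) := by ring
    _ ≤ C * (ε ^ 2 * ‖U‖) := by
        gcongr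
        exact (div_le_comm₀ hC CS_pos).1 hCS'
    _ = C * ε ^ 2 * ‖U‖ := (mul_assoc _ _ _).symm

theorem IsElliptic.exists_card_residual_le_of_isExpSparse (hA : IsElliptic A m M) {cA a : ℝ}
    (ha : 0 < a) (hdecay : ExpDecay cA a fun l k => A (lp.single 2 k 1) l) (hC₀ : 0 < C₀)
    (hC₀' : C₀ < 1) (hη : 0 < η) (hs : 0 < s) :
    ∃ C > 0, ∃ CS > 0, ∀ {U : ℓ²(K, 𝕜)} {G ε : ℝ}, U ≠ 0 → IsExpSparse η s G U → 0 < ε → ε < 1 →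
      1 - Real.log ε ≤ logComplexity A U CS G ε ∧
      ∀ {Λ : Finset K} {W : ℓ²(K, 𝕜)}, IsGalerkinSeq A Λ U W →
        ∃ S : Finset K, ‖A (U - W) - trunc S (A (U - W))‖ ≤ C₀ * ε ^ 2 * ‖A U‖ ∧
          (S.card : ℝ) ≤ C * logComplexity A U CS G ε ^ (s⁻¹ + 2 * d) := by
  have hM := hA.M_pos
  obtain ⟨c, c_pos, C, C_pos, exists_card_le⟩ := hA.exists_card_residual_le ha hdecay
  have log_C₀_neg : Real.log C₀ < 0 := Real.log_neg hC₀ hC₀'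
  set Clog := 2 - Real.log C₀ with hClog
  have Clog_pos : 0 < Clog := by linarith
  refine ⟨((2 / η) ^ s⁻¹ + 1) * (C * Clog ^ 2) ^ d, by positivity,
    max (Real.exp 1 * M) (2 * M / (c * C₀)), by positivity, fun {U G ε} hU hsparse hε hε1 => ?_⟩
  set L := logComplexity A U (max (Real.exp 1 * M) (2 * M / (c * C₀))) G ε
  have log_ε_neg : Real.log ε < 0 := Real.log_neg hε hε1
  have one_sub_log_le : 1 - Real.log ε ≤ L :=
    hA.one_sub_log_le_logComplexity hU hsparse.norm_le (le_max_left _ _) hε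
  have one_le_L : 1 ≤ L := by linarith
  refine ⟨one_sub_log_le, fun {Λ W} hW => ?_⟩
  obtain ⟨S₀, card_S₀_le, norm_sub_le⟩ := hsparse.exists_card_le hη hs one_le_L
  have tail_le : ‖U - trunc S₀ U‖ ≤ c * (C₀ * ε ^ 2) * ‖U‖ := by
    rw [← mul_assoc]
    exact norm_sub_le.trans (hA.mul_exp_neg_logComplexity_le hU hsparse.norm_le
      (le_max_left _ _) (by positivity) (le_max_right _ _) hε)
  have tol_lt_one : C₀ * ε ^ 2 < 1 := mul_lt_one_of_nonneg_of_lt_one_left hC₀.le hC₀'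
    (pow_le_one₀ hε.le hε1.le)
  obtain ⟨S, residual_le, card_le⟩ := exists_card_le hW (by positivity) tol_lt_one tail_le
  have one_sub_log_tol_nonneg : 0 ≤ 1 - Real.log (C₀ * ε ^ 2) := by
    linarith [Real.log_neg (by positivity) tol_lt_one]
  have one_sub_log_tol_le : 1 - Real.log (C₀ * ε ^ 2) ≤ Clog * L := by
    rw [Real.log_mul hC₀.ne' (by positivity), Real.log_pow, Nat.cast_two]
    have : -Real.log C₀ ≤ -Real.log C₀ * L := le_mul_of_one_le_right (by linarith) one_le_L
    rw [hClog]
    linarith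
  refine ⟨S, residual_le, card_le.trans ?_⟩
  calc (S₀.card : ℝ) * (C * (1 - Real.log (C₀ * ε ^ 2)) ^ 2) ^ d
      ≤ ((2 / η) ^ s⁻¹ + 1) * L ^ s⁻¹ * (C * (Clog * L) ^ 2) ^ d := by gcongr
    _ = ((2 / η) ^ s⁻¹ + 1) * (C * Clog ^ 2) ^ d * (L ^ s⁻¹ * L ^ (2 * d)) := by
        rw [mul_pow Clog, ← mul_assoc, mul_pow _ (L ^ 2), ← pow_mul]
        ring
    _ = ((2 / η) ^ s⁻¹ + 1) * (C * Clog ^ 2) ^ d * L ^ (s⁻¹ + 2 * d) := by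
        rw [Real.rpow_add (by positivity)]
        norm_cast

end SparseResidual

section Run

variable {d : ℕ} {K : Set (Fin d → ℤ)} {𝕜 : Type} [RCLike 𝕜] {A : ℓ²(K, 𝕜) →L[𝕜] ℓ²(K, 𝕜)}
  {C₀ : ℝ}

/-- The bulk criterion `θ ‖r‖ ≤ ‖P_S r‖` with the dynamic marking parameter `θ`, for the residual
`r = A (U - W)`: as `1 - θ² = C₀² ‖r‖² / ‖A U‖²`, it bounds the part of `r` outside of `S`. -/
def IsMarking (A : ℓ²(K, 𝕜) →L[𝕜] ℓ²(K, 𝕜)) (C₀ : ℝ) (U W : ℓ²(K, 𝕜)) (S : Finset K) : Prop :=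
  ‖A (U - W) - trunc S (A (U - W))‖ ≤ C₀ * ‖A (U - W)‖ ^ 2 / ‖A U‖

theorem isMarking_iff (hC₀ : 0 ≤ C₀) {U W : ℓ²(K, 𝕜)} {S : Finset K} :
    IsMarking A C₀ U W S ↔
      (1 - C₀ ^ 2 * ‖A (U - W)‖ ^ 2 / ‖A U‖ ^ 2) * ‖A (U - W)‖ ^ 2 ≤
        ‖trunc S (A (U - W))‖ ^ 2 := by
  have norm_sq_eq := norm_sq_eq_trunc_add S (A (U - W))
  have bound_nonneg : 0 ≤ C₀ * ‖A (U - W)‖ ^ 2 / ‖A U‖ := by positivity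
  have bound_sq : (C₀ * ‖A (U - W)‖ ^ 2 / ‖A U‖) ^ 2 =
      C₀ ^ 2 * ‖A (U - W)‖ ^ 2 / ‖A U‖ ^ 2 * ‖A (U - W)‖ ^ 2 := by ring
  rw [IsMarking, ← pow_le_pow_iff_left₀ (norm_nonneg _) bound_nonneg two_ne_zero, bound_sq,
    sub_mul, one_mul]
  constructor <;> intro h <;> linarith

/-- Marking and enrichment in one pass through the loop of the algorithm: `S` is a marked set of
minimal cardinality for the Galerkin approximation `W` on `Λ`, and the new index set is `Λ'`; the
enrichment radius is at most `ρ`. -/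
structure IsSparseStep (A : ℓ²(K, 𝕜) →L[𝕜] ℓ²(K, 𝕜)) (C₀ ρ : ℝ) (U : ℓ²(K, 𝕜)) (Λ : Finset K)
    (W : ℓ²(K, 𝕜)) (S Λ' : Finset K) : Prop where
  marking : IsMarking A C₀ U W S
  card_min : ∀ S', IsMarking A C₀ U W S' → S.card ≤ S'.card
  marked_subset : S ⊆ Λ'
  subset : Λ ⊆ Λ'
  subset_union_enlarge : Λ' ⊆ Λ ∪ enlarge S ρ

/-- A run of the algorithm with tolerance `ε` in terms of coefficient sequences, with enrichment
radii of at most `ρ`. Of the stopping tests only the failed ones are recorded. -/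
structure IsSparseRun (A : ℓ²(K, 𝕜) →L[𝕜] ℓ²(K, 𝕜)) (C₀ ρ : ℝ) (U : ℓ²(K, 𝕜)) (ε : ℝ) (n : ℕ)
    (Λ : ℕ → Finset K) (W : ℕ → ℓ²(K, 𝕜)) : Prop where
  init_set : Λ 0 = ∅
  galerkin : ∀ k ≤ n + 1, IsGalerkinSeq A (Λ k) U (W k)
  le_residual : ∀ k ≤ n, ε * ‖A U‖ ≤ ‖A (U - W k)‖
  step : ∀ k ≤ n, ∃ S, IsSparseStep A C₀ ρ U (Λ k) (W k) S (Λ (k + 1))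

variable {m M ρ b ε : ℝ} {U W W' : ℓ²(K, 𝕜)} {S S' Λ Λ' : Finset K} {n : ℕ}

theorem IsMarking.mul_norm_sq_le (h : IsMarking A C₀ U W S) (hA : IsElliptic A m M) (hU : U ≠ 0)
    (hW : IsGalerkinSeq A Λ U W) :
    (1 - C₀ ^ 2 * (M / m)) * ‖A (U - W)‖ ^ 2 ≤ ‖trunc S (A (U - W))‖ ^ 2 := by
  have hAU := hA.norm_apply_pos hU
  have unmarked_sq_le : ‖A (U - W) - trunc S (A (U - W))‖ ^ 2 ≤
      C₀ ^ 2 * (M / m) * ‖A (U - W)‖ ^ 2 :=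
    calc _ ≤ (C₀ * ‖A (U - W)‖ ^ 2 / ‖A U‖) ^ 2 := by gcongr; exact h
      _ = C₀ ^ 2 * ‖A (U - W)‖ ^ 2 / ‖A U‖ ^ 2 * ‖A (U - W)‖ ^ 2 := by ring
      _ ≤ C₀ ^ 2 * (M / m * ‖A U‖ ^ 2) / ‖A U‖ ^ 2 * ‖A (U - W)‖ ^ 2 := by
          gcongr
          exact hW.norm_apply_sub_sq_le hA
      _ = C₀ ^ 2 * (M / m) * ‖A (U - W)‖ ^ 2 := by field_simp
  linarith [norm_sq_eq_trunc_add S (A (U - W))]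

theorem isMarking_of_norm_sub_trunc_le (hA : IsElliptic A m M) (hU : U ≠ 0) (hC₀ : 0 ≤ C₀)
    (hε : 0 ≤ ε) (hres : ε * ‖A U‖ ≤ ‖A (U - W)‖)
    (hS : ‖A (U - W) - trunc S (A (U - W))‖ ≤ C₀ * ε ^ 2 * ‖A U‖) : IsMarking A C₀ U W S := by
  have hAU := hA.norm_apply_pos hU
  calc _ ≤ C₀ * ε ^ 2 * ‖A U‖ := hS
    _ = C₀ * (ε * ‖A U‖) ^ 2 / ‖A U‖ := by field_simp
    _ ≤ C₀ * ‖A (U - W)‖ ^ 2 / ‖A U‖ := by gcongr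

theorem IsSparseStep.energy_le (h : IsSparseStep A C₀ ρ U Λ W S Λ') (hA : IsElliptic A m M)
    (hC₀ : C₀ ^ 2 ≤ m / M) (hU : U ≠ 0) (hW : IsGalerkinSeq A Λ U W)
    (hW' : IsGalerkinSeq A Λ' U W') :
    energy A (U - W') ≤ (1 - (m / M - C₀ ^ 2)) * energy A (U - W) := by
  have hm := hA.m_pos
  have hM := hA.M_pos
  have bulk_nonneg : 0 ≤ 1 - C₀ ^ 2 * (M / m) := by
    rw [sub_nonneg, ← inv_div m M, ← div_eq_mul_inv, div_le_one (by positivity)]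
    exact hC₀
  have contraction := hW'.energy_le_mul hA (trunc_eq_self_of_subset h.subset hW.supp)
    h.marked_subset bulk_nonneg (h.marking.mul_norm_sq_le hA hU hW)
  have rate_eq : 1 - (1 - C₀ ^ 2 * (M / m)) * (m / M) = 1 - (m / M - C₀ ^ 2) := by field_simp
  rwa [rate_eq] at contraction

theorem IsSparseStep.card_le (h : IsSparseStep A C₀ ρ U Λ W S Λ') (hρ : 0 ≤ ρ)
    (hS' : IsMarking A C₀ U W S') (hb : (S'.card : ℝ) ≤ b) :
    (Λ'.card : ℝ) ≤ Λ.card + b * (2 * ρ + 1) ^ d := by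
  have card_S_le : (S.card : ℝ) ≤ S'.card := by exact_mod_cast h.card_min S' hS'
  calc (Λ'.card : ℝ) ≤ Λ.card + (enlarge S ρ).card := by
        exact_mod_cast (Finset.card_le_card h.subset_union_enlarge).trans (Finset.card_union_le _ _)
    _ ≤ Λ.card + S.card * (2 * ρ + 1) ^ d := by gcongr; exact card_enlarge_le S hρ
    _ ≤ Λ.card + b * (2 * ρ + 1) ^ d := by gcongr; exact card_S_le.trans hb

namespace IsSparseRun

variable {Λ : ℕ → Finset K} {W : ℕ → ℓ²(K, 𝕜)} {k : ℕ}

theorem energy_le (h : IsSparseRun A C₀ ρ U ε n Λ W) (hA : IsElliptic A m M)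
    (hC₀ : C₀ ^ 2 ≤ m / M) (hU : U ≠ 0) (hk : k ≤ n + 1) :
    energy A (U - W k) ≤ (1 - (m / M - C₀ ^ 2)) ^ k * energy A U := by
  have rate_nonneg : 0 ≤ 1 - (m / M - C₀ ^ 2) := by
    linarith [sq_nonneg C₀, (div_le_one hA.M_pos).2 hA.m_le_M]
  induction k with
  | zero =>
    have start_le := (h.galerkin 0 hk).energy_le hA (map_zero _)
    rw [sub_zero] at start_le
    rwa [pow_zero, one_mul]
  | succ k ih =>
    obtain ⟨S, hstep⟩ := h.step k (by lia)
    calc energy A (U - W (k + 1)) ≤ (1 - (m / M - C₀ ^ 2)) * energy A (U - W k) :=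
          hstep.energy_le hA hC₀ hU (h.galerkin k (by lia)) (h.galerkin (k + 1) hk)
      _ ≤ (1 - (m / M - C₀ ^ 2)) * ((1 - (m / M - C₀ ^ 2)) ^ k * energy A U) := by
          gcongr
          exact ih (by lia)
      _ = (1 - (m / M - C₀ ^ 2)) ^ (k + 1) * energy A U := by ring

theorem length_mul_le (h : IsSparseRun A C₀ ρ U ε n Λ W) (hA : IsElliptic A m M)
    (hC₀ : C₀ ^ 2 ≤ m / M) (hq : 0 < 1 - (m / M - C₀ ^ 2)) (hU : U ≠ 0) (hε : 0 < ε) :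
    n * -Real.log (1 - (m / M - C₀ ^ 2)) ≤ Real.log (M / m) - 2 * Real.log ε := by
  have hm := hA.m_pos
  have hM := hA.M_pos
  set q := 1 - (m / M - C₀ ^ 2)
  have sq_le : ε ^ 2 * ‖A U‖ ^ 2 ≤ M / m * q ^ n * ‖A U‖ ^ 2 :=
    calc ε ^ 2 * ‖A U‖ ^ 2 = (ε * ‖A U‖) ^ 2 := (mul_pow _ _ _).symm
      _ ≤ ‖A (U - W n)‖ ^ 2 := by gcongr; exact h.le_residual n le_rfl
      _ ≤ M * energy A (U - W n) := hA.norm_apply_sq_le _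
      _ ≤ M * (q ^ n * energy A U) := by gcongr; exact h.energy_le hA hC₀ hU n.le_succ
      _ = M / m * q ^ n * (m * energy A U) := by field_simp
      _ ≤ M / m * q ^ n * ‖A U‖ ^ 2 := by gcongr; exact hA.mul_energy_le_norm_apply_sq U
  have hAU := hA.norm_apply_pos hU
  have log_le := Real.log_le_log (by positivity) (le_of_mul_le_mul_right sq_le (by positivity))
  rw [Real.log_mul (by positivity) (by positivity), Real.log_pow, Real.log_pow, Nat.cast_two]
    at log_le
  linarith

theorem card_le (h : IsSparseRun A C₀ ρ U ε n Λ W) (hA : IsElliptic A m M) (hU : U ≠ 0)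
    (hC₀ : 0 ≤ C₀) (hε : 0 ≤ ε) (hρ : 0 ≤ ρ)
    (hb : ∀ {Λ W}, IsGalerkinSeq A Λ U W → ∃ S,
      ‖A (U - W) - trunc S (A (U - W))‖ ≤ C₀ * ε ^ 2 * ‖A U‖ ∧ (S.card : ℝ) ≤ b)
    (hk : k ≤ n + 1) : ((Λ k).card : ℝ) ≤ k * (b * (2 * ρ + 1) ^ d) := by
  induction k with
  | zero => simp [h.init_set]
  | succ k ih =>
    obtain ⟨S', residual_le, card_S'_le⟩ := hb (h.galerkin k (by lia))
    have isMarking_S' := isMarking_of_norm_sub_trunc_le hA hU hC₀ hε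
      (h.le_residual k (by lia)) residual_le
    obtain ⟨S, hstep⟩ := h.step k (by lia)
    push_cast
    linarith [hstep.card_le hρ isMarking_S' card_S'_le, ih (by lia)]

end IsSparseRun

theorem IsElliptic.exists_length_le (hA : IsElliptic A m M) (hC₀ : 0 < C₀) (hC₀' : C₀ ^ 2 < m / M) :
    ∃ C > 0, ∀ {ρ ε : ℝ} {U : ℓ²(K, 𝕜)} {n : ℕ} {Λ : ℕ → Finset K} {W : ℕ → ℓ²(K, 𝕜)}, U ≠ 0 →
      0 < ε → ε < 1 → IsSparseRun A C₀ ρ U ε n Λ W → (n : ℝ) + 1 ≤ C * (1 - Real.log ε) := by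
  have rate_pos : 0 < 1 - (m / M - C₀ ^ 2) := by
    linarith [sq_pos_of_pos hC₀, (div_le_one hA.M_pos).2 hA.m_le_M]
  have log_rate_neg := Real.log_neg rate_pos (by linarith)
  have log_nonneg : 0 ≤ Real.log (M / m) := Real.log_nonneg hA.one_le_div
  set γ := -Real.log (1 - (m / M - C₀ ^ 2))
  have γ_pos : 0 < γ := neg_pos.2 log_rate_neg
  refine ⟨(Real.log (M / m) + 2) / γ + 1, by positivity, fun {ρ ε U n Λ W} hU hε hε1 h => ?_⟩
  have log_ε_neg : Real.log ε < 0 := Real.log_neg hε hε1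
  have length_mul_le := h.length_mul_le hA hC₀'.le rate_pos hU hε
  have length_le : (n : ℝ) ≤ (Real.log (M / m) + 2) / γ * (1 - Real.log ε) := by
    rw [div_mul_eq_mul_div, le_div_iff₀ γ_pos]
    have : Real.log (M / m) ≤ Real.log (M / m) * (1 - Real.log ε) :=
      le_mul_of_one_le_right log_nonneg (by linarith)
    linarith
  linarith

theorem IsElliptic.exists_run_bounds (hA : IsElliptic A m M) {cA a : ℝ} (ha : 0 < a)
    (hdecay : ExpDecay cA a fun l k => A (lp.single 2 k 1) l) (hC₀ : 0 < C₀)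
    (hC₀' : C₀ ^ 2 < m / M) {η s Cρ : ℝ} (hη : 0 < η) (hs : 0 < s) (hCρ : 0 < Cρ) :
    ∃ C > 0, ∃ CS > 0, ∀ {U : ℓ²(K, 𝕜)} {G ε : ℝ} {n : ℕ} {Λ : ℕ → Finset K} {W : ℕ → ℓ²(K, 𝕜)},
      U ≠ 0 → IsExpSparse η s G U → 0 < ε → ε < 1 →
      IsSparseRun A C₀ (Cρ * (1 - Real.log ε)) U ε n Λ W →
      1 ≤ logComplexity A U CS G ε ∧ (n : ℝ) + 1 ≤ C * logComplexity A U CS G ε ∧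
        ∀ k ≤ n + 1, ((Λ k).card : ℝ) ≤ C * logComplexity A U CS G ε ^ (s⁻¹ + 3 * d + 1) := by
  have C₀_lt_one : C₀ < 1 := lt_of_pow_lt_pow_left₀ 2 zero_le_one <| by
    rw [one_pow]
    exact hC₀'.trans_le ((div_le_one hA.M_pos).2 hA.m_le_M)
  obtain ⟨C₁, C₁_pos, CS, CS_pos, sparse_residual⟩ :=
    hA.exists_card_residual_le_of_isExpSparse ha hdecay hC₀ C₀_lt_one hη hs
  obtain ⟨C₂, C₂_pos, length_le⟩ := hA.exists_length_le hC₀ hC₀'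
  refine ⟨C₂ * (C₁ * (2 * Cρ + 1) ^ d) + C₂, by positivity, CS, CS_pos,
    fun {U G ε n Λ W} hU hsparse hε hε1 hrun => ?_⟩
  obtain ⟨one_sub_log_le, exists_support⟩ := sparse_residual hU hsparse hε hε1
  set L := logComplexity A U CS G ε
  have log_ε_neg : Real.log ε < 0 := Real.log_neg hε hε1
  have one_le_L : 1 ≤ L := by linarith
  have length_le_L : (n : ℝ) + 1 ≤ C₂ * L := (length_le hU hε hε1 hrun).trans (by gcongr)
  refine ⟨one_le_L, length_le_L.trans (by gcongr; exact le_add_of_nonneg_left (by positivity)),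
    fun k hk => ?_⟩
  have radius_nonneg : 0 ≤ Cρ * (1 - Real.log ε) := mul_nonneg hCρ.le (by linarith)
  have radius_le : 2 * (Cρ * (1 - Real.log ε)) + 1 ≤ (2 * Cρ + 1) * L := by
    have : Cρ * (1 - Real.log ε) ≤ Cρ * L := by gcongr
    linarith
  have k_le : (k : ℝ) ≤ C₂ * L := le_trans (by exact_mod_cast hk) length_le_L
  calc ((Λ k).card : ℝ)
      ≤ k * (C₁ * L ^ (s⁻¹ + 2 * d) * (2 * (Cρ * (1 - Real.log ε)) + 1) ^ d) :=
        hrun.card_le hA hU hC₀.le hε.le radius_nonneg exists_support hk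
    _ ≤ C₂ * L * (C₁ * L ^ (s⁻¹ + 2 * d) * ((2 * Cρ + 1) * L) ^ d) := by gcongr
    _ = C₂ * (C₁ * (2 * Cρ + 1) ^ d) * (L ^ (s⁻¹ + 2 * d) * L ^ d * L) := by
        rw [mul_pow _ L]
        ring
    _ = C₂ * (C₁ * (2 * Cρ + 1) ^ d) * L ^ (s⁻¹ + 3 * d + 1) := by
        rw [← Real.rpow_natCast L d, ← Real.rpow_add (by positivity),
          ← Real.rpow_add_one (by positivity)]
        ring_nf
    _ ≤ (C₂ * (C₁ * (2 * Cρ + 1) ^ d) + C₂) * L ^ (s⁻¹ + 3 * d + 1) := by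
        gcongr
        exact le_add_of_nonneg_right C₂_pos.le

end Run

section Coefficients

variable {d : ℕ} {𝕜 : Type} [RCLike 𝕜] {K : Set (Fin d → ℤ)}

theorem exists_card_le_forall_mem_of_forall_card_ne {α : Type*} {N : ℕ}
    (h : ∀ S : Finset α, S.card ≠ N) : ∃ S : Finset α, S.card ≤ N ∧ ∀ a, a ∈ S := by
  have : Finite α := by
    by_contra infinite
    rw [not_finite_iff_infinite] at infinite
    obtain ⟨S, card_eq⟩ := Infinite.exists_subset_card_eq α N
    exact h S card_eq
  have := Fintype.ofFinite α
  refine ⟨Finset.univ, ?_, Finset.mem_univ⟩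
  by_contra! lt_card
  obtain ⟨S, -, card_eq⟩ := Finset.exists_subset_card_eq lt_card.le
  exact h S card_eq

namespace RieszBasis

variable {V : Type} [NormedAddCommGroup V] [NormedSpace 𝕜 V] (B : RieszBasis 𝕜 K V)

theorem sqrt_weight_ne_zero (k : K) : ((√(B.weight k) : ℝ) : 𝕜) ≠ 0 :=
  RCLike.ofReal_ne_zero.2 (Real.sqrt_pos.2 (B.weight_pos k)).ne'

theorem φ_eq (k : K) :
    B.φ k = ((√(B.weight k) : ℝ) : 𝕜) • B.repr.symm (lp.single 2 k (1 : 𝕜)) := by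
  rw [← map_smul, ← lp.single_smul, smul_eq_mul, mul_one, ← B.repr_φ,
    ContinuousLinearEquiv.symm_apply_apply]

theorem repr_coeff_smul_φ (v : V) (k : K) :
    B.repr (B.coeff v k • B.φ k) = lp.single 2 k (B.repr v k) := by
  rw [map_smul, B.repr_φ, ← lp.single_smul, coeff, smul_eq_mul,
    div_mul_cancel₀ _ (B.sqrt_weight_ne_zero k)]

theorem repr_proj (Λ : Finset K) (v : V) : B.repr (B.proj Λ v) = trunc Λ (B.repr v) := by
  simp only [proj, map_sum, repr_coeff_smul_φ, trunc_eq_sum_single]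

theorem phiNorm_sub_proj (Λ : Finset K) (v : V) :
    B.phiNorm (v - B.proj Λ v) = ‖B.repr v - trunc Λ (B.repr v)‖ := by
  rw [phiNorm, map_sub, repr_proj]

theorem trunc_repr_of_mem_subspace {Λ : Finset K} {w : V} (hw : w ∈ B.subspace Λ) :
    trunc Λ (B.repr w) = B.repr w := by
  induction hw using Submodule.span_induction with
  | mem x hx =>
    obtain ⟨k, hk, rfl⟩ := hx
    ext l
    rw [B.repr_φ, trunc_apply]
    split_ifs with hl
    · rfl
    · rw [lp.single_apply_ne]
      rintro rfl
      exact hl hk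
  | zero => rw [map_zero, map_zero]
  | add x y _ _ hx hy => rw [map_add, map_add, hx, hy]
  | smul c x _ hx => rw [map_smul, map_smul, hx]

theorem βLo_le_βHi [Nontrivial V] : B.βLo ≤ B.βHi := by
  obtain ⟨v, hv⟩ := exists_ne (0 : V)
  exact le_of_mul_le_mul_right ((B.le_repr v).trans (B.repr_le v)) (norm_pos_iff.2 hv)

theorem βHi_pos [Nontrivial V] : 0 < B.βHi := B.βLo_pos.trans_le B.βLo_le_βHi

theorem dualNorm_eq_norm {g : V → 𝕜} {x : ℓ²(K, 𝕜)} (h : ∀ k, B.dualCoeff g k = x k) :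
    B.dualNorm g = ‖x‖ := by
  have norm_sq_eq := lp.norm_rpow_eq_tsum (p := 2) (by norm_num) x
  simp only [ENNReal.toReal_ofNat, Real.rpow_ofNat] at norm_sq_eq
  simp only [dualNorm, h]
  rw [← norm_sq_eq, Real.sqrt_sq (norm_nonneg x)]

variable {B} {η t : ℝ} {v : V}

theorem MemGevrey.bestError_le (hv : B.MemGevrey η t v) (N : ℕ) :
    B.bestError v N ≤ B.gevreyNorm η t v * Real.exp
      (-(η * unitBallVolume d ^ (-(t / (d : ℝ))) * (N : ℝ) ^ (t / (d : ℝ)))) := by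
  rw [Real.exp_neg, ← div_eq_mul_inv, le_div_iff₀ (Real.exp_pos _)]
  exact le_ciSup hv N

theorem MemGevrey.norm_repr_le (hv : B.MemGevrey η t v) (hs : 0 < t / d) :
    ‖B.repr v‖ ≤ B.gevreyNorm η t v := by
  have bestError_zero : B.bestError v 0 = ‖B.repr v‖ := by
    have : Unique {Λ : Finset K // Λ.card = 0} :=
      ⟨⟨⟨∅, Finset.card_empty⟩⟩, fun Λ => Subtype.ext (Finset.card_eq_zero.1 Λ.2)⟩
    rw [bestError, ciInf_unique, phiNorm_sub_proj, Finset.card_eq_zero.1 (default :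
      {Λ : Finset K // Λ.card = 0}).2, trunc_eq_sum_single, Finset.sum_empty, sub_zero]
  have bestError_zero_le := hv.bestError_le 0
  rwa [bestError_zero, Nat.cast_zero, Real.zero_rpow hs.ne', mul_zero, neg_zero, Real.exp_zero,
    mul_one] at bestError_zero_le

theorem MemGevrey.isExpSparse (hv : B.MemGevrey η t v) (hs : 0 < t / d) :
    IsExpSparse (η * unitBallVolume d ^ (-(t / (d : ℝ)))) (t / d) (B.gevreyNorm η t v)
      (B.repr v) := by
  refine ⟨hv.norm_repr_le hs, fun N => ?_⟩
  have G_nonneg : 0 ≤ B.gevreyNorm η t v := (norm_nonneg _).trans (hv.norm_repr_le hs)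
  rcases G_nonneg.eq_or_lt with G_eq_zero | G_pos
  · have repr_eq_zero : B.repr v = 0 := norm_le_zero_iff.1 (G_eq_zero ▸ hv.norm_repr_le hs)
    refine ⟨∅, N.zero_le, ?_⟩
    rw [repr_eq_zero, map_zero, sub_zero, norm_zero]
    positivity
  by_cases hN : ∃ Λ : Finset K, Λ.card = N
  · obtain ⟨Λ₀, hΛ₀⟩ := hN
    have : Nonempty {Λ : Finset K // Λ.card = N} := ⟨⟨Λ₀, hΛ₀⟩⟩
    obtain ⟨Λ, error_lt⟩ := exists_lt_of_ciInf_lt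
      ((hv.bestError_le N).trans_lt (lt_two_mul_self (mul_pos G_pos (Real.exp_pos _))))
    refine ⟨Λ.1, Λ.2.le, ?_⟩
    rw [← phiNorm_sub_proj]
    exact error_lt.le
  · obtain ⟨S, card_le, forall_mem⟩ :=
      exists_card_le_forall_mem_of_forall_card_ne (not_exists.1 hN)
    have trunc_eq : trunc S (B.repr v) = B.repr v := by
      ext k
      rw [trunc_apply, if_pos (forall_mem k)]
    refine ⟨S, card_le, ?_⟩
    rw [trunc_eq, sub_self, norm_zero]
    positivity

end RieszBasis

theorem unitBallVolume_pos (d : ℕ) : 0 < unitBallVolume d :=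
  ENNReal.toReal_pos (Metric.measure_ball_pos _ _ one_pos).ne' measure_ball_lt_top.ne

end Coefficients

section StiffnessOperator

variable {d : ℕ} {𝕜 : Type} [RCLike 𝕜] {K : Set (Fin d → ℤ)}

/-- The stiffness matrix as an operator on `ℓ²(𝒦)`. -/
def stiffnessOp (P : EllipticProblem d) (B : RieszBasis 𝕜 K (P.V 𝕜)) : ℓ²(K, 𝕜) →L[𝕜] ℓ²(K, 𝕜) :=
  ContinuousLinearMap.adjoint (B.repr.symm : ℓ²(K, 𝕜) →L[𝕜] P.V 𝕜) ∘L P.operator ∘L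
    (B.repr.symm : ℓ²(K, 𝕜) →L[𝕜] P.V 𝕜)

variable {P : EllipticProblem d} (B : RieszBasis 𝕜 K (P.V 𝕜))

theorem inner_stiffnessOp (x y : ℓ²(K, 𝕜)) :
    inner 𝕜 x (stiffnessOp P B y) = P.form (B.repr.symm y) (B.repr.symm x) := by
  rw [stiffnessOp, ContinuousLinearMap.comp_apply, ContinuousLinearMap.adjoint_inner_right]
  exact P.inner_operator _ _

theorem stiffnessOp_apply (x : ℓ²(K, 𝕜)) (k : K) :
    stiffnessOp P B x k = P.form (B.repr.symm x) (B.repr.symm (lp.single 2 k (1 : 𝕜))) := by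
  rw [← inner_stiffnessOp, lp.inner_single_left, RCLike.inner_apply, map_one, mul_one]

theorem dualCoeff_form (v : P.V 𝕜) (k : K) :
    B.dualCoeff (P.form v) k = stiffnessOp P B (B.repr v) k := by
  rw [stiffnessOp_apply, RieszBasis.dualCoeff, B.φ_eq, ← P.conj_form, P.form_smul_left, map_mul,
    P.conj_form, RCLike.conj_ofReal, mul_div_cancel_left₀ _ (B.sqrt_weight_ne_zero k),
    ContinuousLinearEquiv.symm_apply_apply]

theorem stiffnessOp_single (l k : K) :
    stiffnessOp P B (lp.single 2 k 1) l = stiffness P B l k := by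
  have φ_ne_zero := B.sqrt_weight_ne_zero k
  have single_eq : lp.single 2 k (1 : 𝕜) = ((√(B.weight k) : ℝ) : 𝕜)⁻¹ • B.repr (B.φ k) := by
    rw [B.repr_φ, ← lp.single_smul, smul_eq_mul, inv_mul_cancel₀ φ_ne_zero]
  rw [single_eq, map_smul, lp.coeFn_smul, Pi.smul_apply, ← dualCoeff_form, RieszBasis.dualCoeff,
    stiffness, smul_eq_mul, RCLike.ofReal_mul, inv_mul_eq_div, div_div]

theorem energyNorm_eq_sqrt_energy (v : P.V 𝕜) :
    P.energyNorm v = √(energy (stiffnessOp P B) (B.repr v)) := by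
  rw [energy, inner_stiffnessOp, ContinuousLinearEquiv.symm_apply_apply, EllipticProblem.energyNorm]

theorem isElliptic_stiffnessOp [Nontrivial (P.V 𝕜)] :
    IsElliptic (stiffnessOp P B) (P.αLo / B.βHi ^ 2) (P.αHi / B.βLo ^ 2) := by
  have hLo := B.βLo_pos
  have hHi := B.βHi_pos
  have hαLo := P.αLo_pos
  have hαHi := P.αHi_pos
  refine ⟨fun x y => ?_, by positivity, ?_, fun x => ?_, fun x => ?_⟩
  · rw [ContinuousLinearMap.coe_coe, ← inner_conj_symm, inner_stiffnessOp, inner_stiffnessOp,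
      P.conj_form]
  · gcongr
    exacts [P.αLo_le_αHi, B.βLo_le_βHi]
  all_goals
    obtain ⟨v, rfl⟩ := B.repr.surjective x
    rw [energy, inner_stiffnessOp, ContinuousLinearEquiv.symm_apply_apply]
  · calc P.αLo / B.βHi ^ 2 * ‖B.repr v‖ ^ 2 ≤ P.αLo / B.βHi ^ 2 * (B.βHi * ‖v‖) ^ 2 := by
          gcongr
          exact B.repr_le v
      _ = P.αLo * ‖v‖ ^ 2 := by field_simp
      _ ≤ RCLike.re (P.form v v) := P.αLo_mul_norm_sq_le_re_form v
  · calc RCLike.re (P.form v v)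
        ≤ P.αHi * ‖v‖ * ‖v‖ := (RCLike.re_le_norm _).trans (P.norm_form_le v v)
      _ = P.αHi / B.βLo ^ 2 * (B.βLo * ‖v‖) ^ 2 := by field_simp
      _ ≤ P.αHi / B.βLo ^ 2 * ‖B.repr v‖ ^ 2 := by gcongr; exact B.le_repr v

end StiffnessOperator

section Residual

variable {d : ℕ} {𝕜 : Type} [RCLike 𝕜] {K : Set (Fin d → ℤ)} {P : EllipticProblem d}
  {B : RieszBasis 𝕜 K (P.V 𝕜)} {f : P.V 𝕜 →L⋆[𝕜] 𝕜} {u w : P.V 𝕜}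

theorem residual_eq_form_sub (hu : P.IsWeakSolution f u) (w : P.V 𝕜) :
    P.residual f w = P.form (u - w) := by
  have form_eq := P.form_add_left (u - w) w
  simp only [sub_add_cancel] at form_eq
  ext v
  rw [EllipticProblem.residual, ← hu v, form_eq, add_sub_cancel_right]

theorem dualCoeff_residual (hu : P.IsWeakSolution f u) (w : P.V 𝕜) (k : K) :
    B.dualCoeff (P.residual f w) k = stiffnessOp P B (B.repr u - B.repr w) k := by
  rw [residual_eq_form_sub hu, dualCoeff_form, map_sub]

theorem dualNorm_residual (hu : P.IsWeakSolution f u) (w : P.V 𝕜) :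
    B.dualNorm (P.residual f w) = ‖stiffnessOp P B (B.repr u - B.repr w)‖ :=
  B.dualNorm_eq_norm (dualCoeff_residual hu w)

theorem dualNorm_eq_norm_stiffnessOp (hu : P.IsWeakSolution f u) :
    B.dualNorm f = ‖stiffnessOp P B (B.repr u)‖ := by
  rw [← funext hu]
  exact B.dualNorm_eq_norm (dualCoeff_form B u)

theorem IsGalerkin.isGalerkinSeq (hu : P.IsWeakSolution f u) {Λ : Finset K}
    (hw : IsGalerkin P B f Λ w) :
    IsGalerkinSeq (stiffnessOp P B) Λ (B.repr u) (B.repr w) := by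
  refine ⟨B.trunc_repr_of_mem_subspace hw.1, ?_⟩
  ext k
  rw [trunc_apply, lp.coeFn_zero, Pi.zero_apply, ite_eq_right_iff]
  intro hk
  rw [← dualCoeff_residual hu, RieszBasis.dualCoeff, EllipticProblem.residual,
    hw.2 _ (Submodule.subset_span ⟨k, hk, rfl⟩), sub_self, zero_div]

theorem energyNorm_sub_le [Nontrivial (P.V 𝕜)] (hu : P.IsWeakSolution f u) (w : P.V 𝕜) :
    P.energyNorm (u - w) ≤ B.βHi / √P.αLo * B.dualNorm (P.residual f w) := by
  have hHi := B.βHi_pos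
  have hα := P.αLo_pos
  rw [energyNorm_eq_sqrt_energy B, dualNorm_residual hu, map_sub]
  refine Real.sqrt_le_iff.2 ⟨by positivity, ?_⟩
  rw [mul_pow, div_pow, Real.sq_sqrt hα.le, ← inv_div, inv_mul_eq_div, le_div_iff₀' (by positivity)]
  exact (isElliptic_stiffnessOp B).mul_energy_le_norm_apply_sq _

end Residual

section GevreyRun

variable {d : ℕ} {𝕜 : Type} [RCLike 𝕜] {K : Set (Fin d → ℤ)} {P : EllipticProblem d}
  {B : RieszBasis 𝕜 K (P.V 𝕜)} {p : Params} {f : P.V 𝕜 →L⋆[𝕜] 𝕜} {u w : P.V 𝕜}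
  {m M ε ρ η t : ℝ} {n k : ℕ}

theorem Params.Admissible.C₀_lt (hp : p.Admissible P B) :
    p.C₀ < √(P.αLo / P.αHi) * (B.βLo / B.βHi) := by
  linarith [hp.C₀_pos, hp.C₀_le]

theorem Params.C₀_sq_lt_div (hC₀ : 0 ≤ p.C₀)
    (hC₀_lt : p.C₀ < √(P.αLo / P.αHi) * (B.βLo / B.βHi)) :
    p.C₀ ^ 2 < P.αLo / B.βHi ^ 2 / (P.αHi / B.βLo ^ 2) := by
  have quotient_nonneg : 0 ≤ P.αLo / P.αHi := (div_pos P.αLo_pos P.αHi_pos).le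
  calc p.C₀ ^ 2 < (√(P.αLo / P.αHi) * (B.βLo / B.βHi)) ^ 2 := by gcongr
    _ = P.αLo / P.αHi * (B.βLo / B.βHi) ^ 2 := by rw [mul_pow, Real.sq_sqrt quotient_nonneg]
    _ = P.αLo / B.βHi ^ 2 / (P.αHi / B.βLo ^ 2) := by
        rw [div_pow, div_mul_div_comm, div_div_div_eq, mul_comm P.αHi]

theorem exists_minRadius_add_one_le (P : EllipticProblem d) (hC₀ : 0 < p.C₀) (hCinv : 0 < p.Cinv)
    (hηinv : 0 < p.ηinv) :
    ∃ C > 0, ∀ {ε θ : ℝ}, 0 < ε → ε < 1 → (p.C₀ * ε) ^ 2 ≤ 1 - θ ^ 2 →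
      minRadius P p θ + 1 ≤ C * (1 - Real.log ε) := by
  have hαLo := P.αLo_pos
  have hαHi := P.αHi_pos
  set κ := p.C₀ / √(P.αLo * P.αHi) / p.Cinv with hκ
  have κ_pos : 0 < κ := by positivity
  refine ⟨1 / p.ηinv * (|Real.log κ| + 1) + 1, by positivity, fun {ε θ} hε hε1 hθ => ?_⟩
  have log_ε_neg : Real.log ε < 0 := Real.log_neg hε hε1
  have κ_mul_le : κ * ε ≤ √((1 - θ ^ 2) / (P.αLo * P.αHi)) / p.Cinv :=
    calc κ * ε = √((p.C₀ * ε) ^ 2 / (P.αLo * P.αHi)) / p.Cinv := by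
          rw [Real.sqrt_div (by positivity), Real.sqrt_sq (by positivity), hκ]
          ring
      _ ≤ √((1 - θ ^ 2) / (P.αLo * P.αHi)) / p.Cinv := by gcongr
  have neg_log_le : -Real.log (√((1 - θ ^ 2) / (P.αLo * P.αHi)) / p.Cinv) ≤
      (|Real.log κ| + 1) * (1 - Real.log ε) := by
    have log_le := Real.log_le_log (by positivity) κ_mul_le
    rw [Real.log_mul κ_pos.ne' hε.ne'] at log_le
    have : |Real.log κ| ≤ |Real.log κ| * (1 - Real.log ε) :=
      le_mul_of_one_le_right (abs_nonneg _) (by linarith)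
    linarith [neg_abs_le (Real.log κ)]
  have radius_le : minRadius P p θ ≤ 1 / p.ηinv * (|Real.log κ| + 1) * (1 - Real.log ε) := by
    refine max_le (mul_nonneg (by positivity) (by linarith)) ?_
    rw [neg_mul, ← mul_neg, mul_assoc]
    gcongr
  linarith

theorem sq_theta (hu : P.IsWeakSolution f u) (hA : IsElliptic (stiffnessOp P B) m M)
    (hC₀ : p.C₀ ^ 2 ≤ m / M) {Λ : Finset K}
    (hw : IsGalerkinSeq (stiffnessOp P B) Λ (B.repr u) (B.repr w)) :
    theta P B p f w ^ 2 = 1 - p.C₀ ^ 2 * ‖stiffnessOp P B (B.repr u - B.repr w)‖ ^ 2 /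
      ‖stiffnessOp P B (B.repr u)‖ ^ 2 := by
  have hm := hA.m_pos
  have hM := hA.M_pos
  rw [theta, dualNorm_residual hu, dualNorm_eq_norm_stiffnessOp hu, Real.sq_sqrt]
  refine sub_nonneg.2 (div_le_one_of_le₀ ?_ (sq_nonneg _))
  calc p.C₀ ^ 2 * ‖stiffnessOp P B (B.repr u - B.repr w)‖ ^ 2
      ≤ m / M * (M / m * ‖stiffnessOp P B (B.repr u)‖ ^ 2) := by
        gcongr
        exact hw.norm_apply_sub_sq_le hA
    _ = ‖stiffnessOp P B (B.repr u)‖ ^ 2 := by field_simp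

theorem bulkCriterion_residual_iff (hu : P.IsWeakSolution f u) (θ : ℝ) (S : Finset K) :
    BulkCriterion P B (P.residual f w) θ S ↔
      θ ^ 2 * ‖stiffnessOp P B (B.repr u - B.repr w)‖ ^ 2 ≤
        ‖trunc S (stiffnessOp P B (B.repr u - B.repr w))‖ ^ 2 := by
  have sum_eq : ∑ k ∈ S, ‖B.dualCoeff (P.residual f w) k‖ ^ 2 =
      ∑ k ∈ S, ‖stiffnessOp P B (B.repr u - B.repr w) k‖ ^ 2 :=
    Finset.sum_congr rfl fun k _ => by rw [dualCoeff_residual hu]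
  rw [BulkCriterion, dualNorm_residual hu, norm_sq_trunc, sum_eq]

theorem bulkCriterion_theta_iff (hu : P.IsWeakSolution f u)
    (hA : IsElliptic (stiffnessOp P B) m M) (hC₀ : 0 ≤ p.C₀) (hC₀' : p.C₀ ^ 2 ≤ m / M)
    {Λ : Finset K} (hw : IsGalerkinSeq (stiffnessOp P B) Λ (B.repr u) (B.repr w)) (S : Finset K) :
    BulkCriterion P B (P.residual f w) (theta P B p f w) S ↔
      IsMarking (stiffnessOp P B) p.C₀ (B.repr u) (B.repr w) S := by
  rw [bulkCriterion_residual_iff hu, sq_theta hu hA hC₀' hw, isMarking_iff hC₀]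

theorem IsStep.exists_isSparseStep (hu : P.IsWeakSolution f u)
    (hA : IsElliptic (stiffnessOp P B) m M) (hC₀ : 0 ≤ p.C₀) (hC₀' : p.C₀ ^ 2 ≤ m / M)
    {Λ Λ' : Finset K} {w' : P.V 𝕜} (h : IsStep P B p f Λ w Λ' w')
    (hw : IsGalerkinSeq (stiffnessOp P B) Λ (B.repr u) (B.repr w))
    (hρ : minRadius P p (theta P B p f w) + 1 ≤ ρ) :
    ∃ S, IsSparseStep (stiffnessOp P B) p.C₀ ρ (B.repr u) Λ (B.repr w) S Λ' := by
  obtain ⟨S, δ, ⟨bulk, card_min⟩, δ_nonneg, δ_lt_one, mem_Λ', -⟩ := h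
  simp only [bulkCriterion_theta_iff hu hA hC₀ hC₀' hw] at bulk card_min
  refine ⟨S, bulk, card_min, fun k hk => ?_, fun k hk => (mem_Λ' k).2 (Or.inl hk), fun k hk => ?_⟩
  · refine (mem_Λ' k).2 (Or.inr ⟨k, hk, ?_⟩)
    rw [latticeDist_self]
    exact add_nonneg (le_max_left _ _) δ_nonneg
  · rw [Finset.mem_union, mem_enlarge]
    exact ((mem_Λ' k).1 hk).imp_right fun ⟨l, hl, dist_le⟩ => ⟨l, hl, by linarith⟩

/-- A complete run of the algorithm for a nonzero functional `f` such that the solution `u` of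
`L u = f` belongs to the Gevrey class `𝒜_G^{η,t}`. -/
structure IsGevreyRun (P : EllipticProblem d) (B : RieszBasis 𝕜 K (P.V 𝕜)) (p : Params) (η t : ℝ)
    (f : P.V 𝕜 →L⋆[𝕜] 𝕜) (u : P.V 𝕜) (ε : ℝ) (n : ℕ) (Λ : ℕ → Finset K) (w : ℕ → P.V 𝕜) :
    Prop where
  f_ne_zero : f ≠ 0
  weak_solution : P.IsWeakSolution f u
  mem_gevrey : B.MemGevrey η t u
  ε_pos : 0 < ε
  ε_lt_one : ε < 1
  run : IsRun P B p f ε n Λ w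

namespace IsGevreyRun

variable {Λ : ℕ → Finset K} {w : ℕ → P.V 𝕜}

theorem u_ne_zero (h : IsGevreyRun P B p η t f u ε n Λ w) : u ≠ 0 := by
  rintro rfl
  refine h.f_ne_zero (ContinuousLinearMap.ext fun v => ?_)
  have form_zero := P.form_smul_left (0 : 𝕜) 0 v
  rwa [smul_zero, zero_mul, h.weak_solution v] at form_zero

theorem nontrivial (h : IsGevreyRun P B p η t f u ε n Λ w) : Nontrivial (P.V 𝕜) :=
  ⟨u, 0, h.u_ne_zero⟩

theorem repr_ne_zero (h : IsGevreyRun P B p η t f u ε n Λ w) : B.repr u ≠ 0 :=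
  (map_ne_zero_iff _ B.repr.injective).2 h.u_ne_zero

theorem gevreyNorm_div_pos (h : IsGevreyRun P B p η t f u ε n Λ w) (hs : 0 < t / d) :
    0 < B.gevreyNorm η t u / B.dualNorm f := by
  have := h.nontrivial
  rw [dualNorm_eq_norm_stiffnessOp h.weak_solution]
  exact div_pos ((norm_pos_iff.2 h.repr_ne_zero).trans_le (h.mem_gevrey.norm_repr_le hs))
    ((isElliptic_stiffnessOp B).norm_apply_pos h.repr_ne_zero)

theorem energyNorm_sub_le (h : IsGevreyRun P B p η t f u ε n Λ w) :
    P.energyNorm (u - w (n + 1)) ≤ B.βHi / √P.αLo * B.dualNorm f * ε := by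
  have := h.nontrivial
  have hβ := B.βHi_pos
  calc P.energyNorm (u - w (n + 1))
      ≤ B.βHi / √P.αLo * B.dualNorm (P.residual f (w (n + 1))) :=
        DynGal.energyNorm_sub_le h.weak_solution _
    _ ≤ B.βHi / √P.αLo * (ε * B.dualNorm f) := by gcongr; exact h.run.terminate
    _ = B.βHi / √P.αLo * B.dualNorm f * ε := by ring

theorem isGalerkinSeq (h : IsGevreyRun P B p η t f u ε n Λ w) (hk : k ≤ n + 1) :
    IsGalerkinSeq (stiffnessOp P B) (Λ k) (B.repr u) (B.repr (w k)) := by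
  cases k with
  | zero =>
    rw [h.run.init_set, h.run.init_iterate, map_zero]
    exact ⟨map_zero _, by rw [trunc_eq_sum_single, Finset.sum_empty]⟩
  | succ k =>
    obtain ⟨S, δ, -, -, -, -, isGalerkin⟩ := h.run.step k (by lia)
    exact isGalerkin.isGalerkinSeq h.weak_solution

theorem le_norm_residual (h : IsGevreyRun P B p η t f u ε n Λ w) (hk : k ≤ n) :
    ε * ‖stiffnessOp P B (B.repr u)‖ ≤ ‖stiffnessOp P B (B.repr u - B.repr (w k))‖ := by
  cases k with
  | zero =>
    rw [h.run.init_iterate, map_zero, sub_zero]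
    exact mul_le_of_le_one_left (norm_nonneg _) h.ε_lt_one.le
  | succ k =>
    rw [← dualNorm_residual h.weak_solution, ← dualNorm_eq_norm_stiffnessOp h.weak_solution]
    exact (h.run.continue_loop k (by lia)).le

theorem sq_le_one_sub_sq_theta (h : IsGevreyRun P B p η t f u ε n Λ w)
    (hA : IsElliptic (stiffnessOp P B) m M) (hC₀ : p.C₀ ^ 2 ≤ m / M) (hk : k ≤ n) :
    (p.C₀ * ε) ^ 2 ≤ 1 - theta P B p f (w k) ^ 2 := by
  have hε := h.ε_pos
  have norm_pos := hA.norm_apply_pos h.repr_ne_zero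
  rw [sq_theta h.weak_solution hA hC₀ (h.isGalerkinSeq (by lia)), sub_sub_cancel,
    le_div_iff₀ (by positivity)]
  calc (p.C₀ * ε) ^ 2 * ‖stiffnessOp P B (B.repr u)‖ ^ 2
      = p.C₀ ^ 2 * (ε * ‖stiffnessOp P B (B.repr u)‖) ^ 2 := by ring
    _ ≤ p.C₀ ^ 2 * ‖stiffnessOp P B (B.repr u - B.repr (w k))‖ ^ 2 := by
        gcongr
        exact h.le_norm_residual hk

theorem isSparseRun (h : IsGevreyRun P B p η t f u ε n Λ w)
    (hA : IsElliptic (stiffnessOp P B) m M) (hC₀ : 0 ≤ p.C₀) (hC₀' : p.C₀ ^ 2 ≤ m / M)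
    (hρ : ∀ {θ : ℝ}, (p.C₀ * ε) ^ 2 ≤ 1 - θ ^ 2 → minRadius P p θ + 1 ≤ ρ) :
    IsSparseRun (stiffnessOp P B) p.C₀ ρ (B.repr u) ε n Λ fun k => B.repr (w k) where
  init_set := h.run.init_set
  galerkin _ hk := h.isGalerkinSeq hk
  le_residual _ hk := h.le_norm_residual hk
  step k hk := (h.run.step k hk).exists_isSparseStep h.weak_solution hA hC₀ hC₀'
    (h.isGalerkinSeq (by lia)) (hρ (h.sq_le_one_sub_sq_theta hA hC₀' hk))

end IsGevreyRun

theorem exists_isGevreyRun_bounds (hd : 1 ≤ d) {cL ηL : ℝ} (hηL : 0 < ηL)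
    (hA : ExpDecay cL ηL (stiffness P B)) (hC₀ : 0 < p.C₀)
    (hC₀_lt : p.C₀ < √(P.αLo / P.αHi) * (B.βLo / B.βHi)) (hCinv : 0 < p.Cinv)
    (hηinv : 0 < p.ηinv) (hη : 0 < η) (ht : 0 < t) :
    ∃ C > 0, ∃ CS > 0, ∀ {f : P.V 𝕜 →L⋆[𝕜] 𝕜} {u : P.V 𝕜} {ε L : ℝ} {n : ℕ} {Λ : ℕ → Finset K}
      {w : ℕ → P.V 𝕜}, IsGevreyRun P B p η t f u ε n Λ w →
      L = Real.log (CS * (B.gevreyNorm η t u / B.dualNorm f) / ε) →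
      1 ≤ L ∧ (n : ℝ) + 1 ≤ C * L ∧
        ∀ k ≤ n + 1, ((Λ k).card : ℝ) ≤ C * L ^ ((d : ℝ) / t + 3 * d + 1) := by
  rcases subsingleton_or_nontrivial (P.V 𝕜) with hV | hV
  · exact ⟨1, one_pos, 1, one_pos,
      fun h => absurd h.nontrivial (not_nontrivial_iff_subsingleton.2 hV)⟩
  have hs : 0 < t / d := div_pos ht (by exact_mod_cast hd)
  have η_pos : 0 < η * unitBallVolume d ^ (-(t / (d : ℝ))) :=
    mul_pos hη (Real.rpow_pos_of_pos (unitBallVolume_pos d) _)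
  have elliptic := isElliptic_stiffnessOp B
  have hC₀_sq := Params.C₀_sq_lt_div hC₀.le hC₀_lt
  have decay : ExpDecay cL ηL fun l k => stiffnessOp P B (lp.single 2 k 1) l := by
    simpa only [stiffnessOp_single] using hA
  obtain ⟨Cρ, Cρ_pos, radius_le⟩ := exists_minRadius_add_one_le P hC₀ hCinv hηinv
  obtain ⟨C, C_pos, CS, CS_pos, bounds⟩ :=
    elliptic.exists_run_bounds hηL decay hC₀ hC₀_sq η_pos hs Cρ_pos
  refine ⟨C, C_pos, CS, CS_pos, fun {f u ε L n Λ w} h hL => ?_⟩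
  have run_bounds := bounds h.repr_ne_zero (h.mem_gevrey.isExpSparse hs) h.ε_pos h.ε_lt_one
    (h.isSparseRun elliptic hC₀.le hC₀_sq.le (radius_le h.ε_pos h.ε_lt_one))
  rwa [logComplexity, ← dualNorm_eq_norm_stiffnessOp h.weak_solution, ← hL, inv_div] at run_bounds

end GevreyRun

section Rate

theorem exists_pos_lt_forall_mul_rpow_le {v C b q : ℝ} (hv : 0 < v) (hC : 0 < C) (hb : 0 < b)
    (hq : 1 ≤ q) :
    ∃ c, 0 < c ∧ c < b ∧ ∀ {L L' : ℝ}, 0 ≤ L → L ≤ L' → C * L ^ q ≤ v * (1 / c * L') ^ q := by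
  set c := min (b / 2) (min 1 (v / C))
  have c_pos : 0 < c := by positivity
  have c_le_one : c ≤ 1 := (min_le_right _ _).trans (min_le_left _ _)
  have c_le_div : c ≤ v / C := (min_le_right _ _).trans (min_le_right _ _)
  refine ⟨c, c_pos, (min_le_left _ _).trans_lt (half_lt_self hb), fun {L L'} hL hLL' => ?_⟩
  have inv_le_rpow : 1 / c ≤ (1 / c) ^ q :=
    Real.self_le_rpow_of_one_le (one_le_one_div c_pos c_le_one) hq
  have le_mul_inv : C ≤ v * (1 / c) := by
    rw [mul_one_div]
    exact (le_div_comm₀ c_pos hC).1 c_le_div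
  calc C * L ^ q ≤ v * (1 / c) ^ q * L ^ q := by
        gcongr
        exact le_mul_inv.trans (by gcongr)
    _ = v * (1 / c * L) ^ q := by rw [Real.mul_rpow (by positivity) hL, mul_assoc]
    _ ≤ v * (1 / c * L') ^ q := by gcongr

theorem log_div_le_log_div_pow_mul_inv {C g ε δ D : ℝ} (hC : 0 < C) (hg : 0 < g) (hε : 0 < ε)
    (hε1 : ε ≤ 1) (hδ : 0 < δ) (hδD : δ ≤ D) :
    Real.log (C * g / ε) ≤ Real.log (max (C + 1) (C / δ) * g / (ε ^ 4 * D⁻¹)) := by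
  have hD : 0 < D := hδ.trans_le hδD
  have le_max_mul : C ≤ max (C + 1) (C / δ) * D :=
    calc C = C / δ * δ := by field_simp
      _ ≤ max (C + 1) (C / δ) * D := by gcongr; exact le_max_right _ _
  have pow_le : ε ^ 4 ≤ ε := pow_le_of_le_one hε.le hε1 (by norm_num)
  refine Real.log_le_log (by positivity) ?_
  calc C * g / ε ≤ max (C + 1) (C / δ) * D * g / ε ^ 4 := by gcongr
    _ = max (C + 1) (C / δ) * g / (ε ^ 4 * D⁻¹) := by field_simp

variable {d : ℕ} {𝕜 : Type} [RCLike 𝕜] {K : Set (Fin d → ℤ)} {P : EllipticProblem d}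
  {B : RieszBasis 𝕜 K (P.V 𝕜)} {s : Solver 𝕜 K} {f : P.V 𝕜 →L⋆[𝕜] 𝕜} {n : ℕ} {Λ : ℕ → Finset K}

theorem workload_le {Csolve b : ℝ} (hs : IsLinearCostSolver P B s Csolve)
    (card_le : ∀ k ≤ n + 1, ((Λ k).card : ℝ) ≤ b) :
    workload P B s f n Λ ≤ (n + 1) * ((|Csolve| + 1) * b) := by
  have pass_le : ∀ k ∈ Finset.range (n + 1),
      ((s (Λ (k + 1)) fun l => B.dualCoeff f l).cost : ℝ) + (Λ (k + 1)).card ≤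
        (|Csolve| + 1) * b := fun k hk => by
    calc ((s (Λ (k + 1)) fun l => B.dualCoeff f l).cost : ℝ) + (Λ (k + 1)).card
        ≤ Csolve * (Λ (k + 1)).card + (Λ (k + 1)).card := by gcongr; exact (hs _ _).2
      _ = (Csolve + 1) * (Λ (k + 1)).card := by ring
      _ ≤ (|Csolve| + 1) * b := by
        gcongr
        · exact le_abs_self Csolve
        · exact card_le _ (Finset.mem_range.1 hk)
  calc workload P B s f n Λ ≤ (Finset.range (n + 1)).card • ((|Csolve| + 1) * b) :=
        Finset.sum_le_card_nsmul _ _ _ pass_le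
    _ = (n + 1) * ((|Csolve| + 1) * b) := by
        rw [Finset.card_range, nsmul_eq_mul, Nat.cast_add_one]

theorem workload_le_rpow {Csolve C L e : ℝ} (hs : IsLinearCostSolver P B s Csolve) (hC : 0 ≤ C)
    (hL : 0 < L) (passes_le : (n : ℝ) + 1 ≤ C * L)
    (card_le : ∀ k ≤ n + 1, ((Λ k).card : ℝ) ≤ C * L ^ e) :
    workload P B s f n Λ ≤ (|Csolve| + 1) * C ^ 2 * L ^ (e + 1) :=
  calc workload P B s f n Λ ≤ (n + 1) * ((|Csolve| + 1) * (C * L ^ e)) := workload_le hs card_le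
    _ ≤ C * L * ((|Csolve| + 1) * (C * L ^ e)) := by gcongr
    _ = (|Csolve| + 1) * C ^ 2 * L ^ (e + 1) := by rw [Real.rpow_add_one hL.ne']; ring

end Rate

end DynGal

end

theorem theorem5p1_general {d : ℕ} (hd : 1 ≤ d) {𝕜 : Type} [RCLike 𝕜] {K : Set (Fin d → ℤ)}
    (P : DynGal.EllipticProblem d) (B : DynGal.RieszBasis 𝕜 K (P.V 𝕜))
    (cL ηL : ℝ) (hηL : 0 < ηL) (hA : DynGal.ExpDecay cL ηL (DynGal.stiffness P B))
    (p : DynGal.Params) (hC₀ : 0 < p.C₀) (hC₀_lt : p.C₀ < √(P.αLo / P.αHi) * (B.βLo / B.βHi))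
    (hCinv : 0 < p.Cinv) (hηinv : 0 < p.ηinv) (η t : ℝ) (hη : 0 < η) (ht : 0 < t) :
    ∃ tS ηS CS : ℝ, 0 < tS ∧ tS < t ∧ 0 < ηS ∧ ηS < η ∧ 0 < CS ∧
      (∀ (f : P.V 𝕜 →L⋆[𝕜] 𝕜) (u : P.V 𝕜) (ε : ℝ) (n : ℕ) (Λ : ℕ → Finset K) (w : ℕ → P.V 𝕜),
        f ≠ 0 → P.IsWeakSolution f u → B.MemGevrey η t u → 0 < ε → ε < 1 →
        DynGal.IsRun P B p f ε n Λ w →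
          P.energyNorm (u - w (n + 1)) ≤ B.βHi / √P.αLo * B.dualNorm f * ε ∧
          ((Λ (n + 1)).card : ℝ) ≤ DynGal.unitBallVolume d *
            (1 / ηS * Real.log (CS * (B.gevreyNorm η t u / B.dualNorm f) / ε)) ^ ((d : ℝ) / tS)) ∧
      (∀ Csolve : ℝ, ∃ ηW : ℝ, 0 < ηW ∧ ηW < ηS ∧ ∀ δ : ℝ, 0 < δ → ∃ CW : ℝ, CS < CW ∧
        ∀ (s : DynGal.Solver 𝕜 K) (f : P.V 𝕜 →L⋆[𝕜] 𝕜) (u : P.V 𝕜) (ε : ℝ) (n : ℕ)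
          (Λ : ℕ → Finset K) (w : ℕ → P.V 𝕜),
          DynGal.IsLinearCostSolver P B s Csolve →
          f ≠ 0 → P.IsWeakSolution f u → B.MemGevrey η t u → 0 < ε → ε < 1 →
          δ ≤ |Real.log (|Real.log ε|)| →
          DynGal.IsRun P B p f ε n Λ w →
            DynGal.workload P B s f n Λ ≤ DynGal.unitBallVolume d *
              (1 / ηW * Real.log (CW * (B.gevreyNorm η t u / B.dualNorm f) /
                (ε ^ 4 * |Real.log (|Real.log ε|)|⁻¹))) ^ ((d : ℝ) / tS)) := by
  obtain ⟨C, C_pos, CS, CS_pos, bounds⟩ :=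
    DynGal.exists_isGevreyRun_bounds hd hηL hA hC₀ hC₀_lt hCinv hηinv hη ht
  have d_pos : (0 : ℝ) < d := by exact_mod_cast hd
  set e : ℝ := d / t + 3 * d + 1
  have div_lt : d / t < e + 1 := by linarith
  have e_nonneg : 0 ≤ e := by positivity
  have one_le : 1 ≤ e + 1 := by linarith
  have v_pos := DynGal.unitBallVolume_pos d
  obtain ⟨ηS, ηS_pos, ηS_lt, card_rate⟩ :=
    DynGal.exists_pos_lt_forall_mul_rpow_le v_pos C_pos hη one_le
  refine ⟨d / (e + 1), ηS, CS, by positivity, (div_lt_comm₀ ht (by positivity)).1 div_lt, ηS_pos,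
    ηS_lt, CS_pos, fun f u ε n Λ w hf hu hG hε hε1 hrun => ?_, fun Csolve => ?_⟩
  · have run : DynGal.IsGevreyRun P B p η t f u ε n Λ w := ⟨hf, hu, hG, hε, hε1, hrun⟩
    obtain ⟨one_le_L, -, card_le⟩ := bounds run rfl
    rw [div_div_cancel₀ d_pos.ne']
    refine ⟨run.energyNorm_sub_le, (card_le _ le_rfl).trans ?_⟩
    refine le_trans ?_ (card_rate (by linarith) le_rfl)
    gcongr C * ?_
    exact Real.rpow_le_rpow_of_exponent_le one_le_L (by linarith)
  · obtain ⟨ηW, ηW_pos, ηW_lt, work_rate⟩ := DynGal.exists_pos_lt_forall_mul_rpow_le v_pos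
      (C := (|Csolve| + 1) * C ^ 2) (by positivity) ηS_pos one_le
    refine ⟨ηW, ηW_pos, ηW_lt, fun δ hδ => ⟨max (CS + 1) (CS / δ),
      (lt_add_one CS).trans_le (le_max_left _ _), ?_⟩⟩
    intro s f u ε n Λ w hs hf hu hG hε hε1 hδε hrun
    have run : DynGal.IsGevreyRun P B p η t f u ε n Λ w := ⟨hf, hu, hG, hε, hε1, hrun⟩
    obtain ⟨one_le_L, passes_le, card_le⟩ := bounds run rfl
    rw [div_div_cancel₀ d_pos.ne']
    exact (DynGal.workload_le_rpow hs C_pos.le (by linarith) passes_le card_le).trans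
      (work_rate (by linarith) (DynGal.log_div_le_log_div_pow_mul_inv CS_pos
        (run.gevreyNorm_div_pos (by positivity)) hε hε1.le hδ hδε))

theorem theorem5p1 {d : ℕ} (hd : 1 ≤ d) {𝕜 : Type} [RCLike 𝕜] {K : Set (Fin d → ℤ)}
    (P : DynGal.EllipticProblem d) (B : DynGal.RieszBasis 𝕜 K (P.V 𝕜))
    (cL ηL : ℝ) (hηL : 0 < ηL) (hA : DynGal.ExpDecay cL ηL (DynGal.stiffness P B))
    (p : DynGal.Params) (hp : p.Admissible P B)
    (η t : ℝ) (hη : 0 < η) (ht : 0 < t) (htd : t ≤ d) :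
    ∃ tS ηS CS : ℝ, 0 < tS ∧ tS < t ∧ 0 < ηS ∧ ηS < η ∧ 0 < CS ∧
      (∀ (f : P.V 𝕜 →L⋆[𝕜] 𝕜) (u : P.V 𝕜) (ε : ℝ) (n : ℕ) (Λ : ℕ → Finset K) (w : ℕ → P.V 𝕜),
        f ≠ 0 → P.IsWeakSolution f u → B.MemGevrey η t u → 0 < ε → ε < 1 →
        DynGal.IsRun P B p f ε n Λ w →
          P.energyNorm (u - w (n + 1)) ≤ B.βHi / √P.αLo * B.dualNorm f * ε ∧
          ((Λ (n + 1)).card : ℝ) ≤ DynGal.unitBallVolume d *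
            (1 / ηS * Real.log (CS * (B.gevreyNorm η t u / B.dualNorm f) / ε)) ^ ((d : ℝ) / tS)) ∧
      (∀ Csolve : ℝ, ∃ ηW : ℝ, 0 < ηW ∧ ηW < ηS ∧ ∀ δ : ℝ, 0 < δ → ∃ CW : ℝ, CS < CW ∧
        ∀ (s : DynGal.Solver 𝕜 K) (f : P.V 𝕜 →L⋆[𝕜] 𝕜) (u : P.V 𝕜) (ε : ℝ) (n : ℕ)
          (Λ : ℕ → Finset K) (w : ℕ → P.V 𝕜),
          DynGal.IsLinearCostSolver P B s Csolve →
          f ≠ 0 → P.IsWeakSolution f u → B.MemGevrey η t u → 0 < ε → ε < 1 →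
          δ ≤ |Real.log (|Real.log ε|)| →
          DynGal.IsRun P B p f ε n Λ w →
            DynGal.workload P B s f n Λ ≤ DynGal.unitBallVolume d *
              (1 / ηW * Real.log (CW * (B.gevreyNorm η t u / B.dualNorm f) /
                (ε ^ 4 * |Real.log (|Real.log ε|)|⁻¹))) ^ ((d : ℝ) / tS)) := by
  exact theorem5p1_general hd P B cL ηL hηL hA p hp.C₀_pos hp.C₀_lt hp.Cinv_pos hp.ηinv_pos η t hη
    ht
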